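/- Let $\Sigma:\mathbb R\to\mathbb R$ be continuous, let $M_0>0$, $\Sigma_0>0$, and assume $\Sigma(s)\ge\Sigma_0$ for $|s|\le M_0$; put $\|\Sigma\|_\infty=\max_{|s|\le M_0}|\Sigma(s)|$. Let $B\subset C^0([0,1])$ be a set of functions with $|h|_{C^0}\le M_0$ for all $h\in B$ (for instance the whole ball of radius $M_0$), and let $C_0$ be a constant such that $$\big|\sqrt{\Sigma(h)}-\sqrt{\Sigma(\tilde h)}\big|_{C^0}\le C_0\,|h-\tilde h|_{C^0}\qquad\text{for all } h,\tilde h\in B .$$ Let $P_0^{-1}$ be the inverse of $-\frac{d^2}{dz^2}+1$ from $L^2([0,1])$ to $H^1_0(0,1)\subset L^2([0,1])$ (weak solutions with Dirichlet conditions), let $N$ be its norm as an operator on $L^2([0,1])$, and for $h\in B$ let $\mathcal L_h=\sqrt{\Sigma(h)}\,P_0^{-1}\sqrt{\Sigma(h)}$ on the real Hilbert space $L^2([0,1])$. All norms $\|\cdot\|$ and scalar products $\langle\cdot,\cdot\rangle$ of functions below are those of $L^2([0,1])$. For every $h\in B$ the operator $\mathcal L_h$ is compact and self-adjoint; it has a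 largest eigenvalue $\mu(h)$; its second largest eigenvalue $\mu_2(h)$, counted with multiplicity, exists and satisfies $\mu_2(h)<\mu(h)$; and there is a unique $\psi_h\in L^2([0,1])$ with $\mathcal L_h\psi_h=\mu(h)\psi_h$ and $\int_0^1\sqrt{\Sigma(h(z))}\,\psi_h(z)\,dz=1$. Moreover there is $\epsilon_0>0$ such that for all $h,\tilde h\in B$ with $|h-\tilde h|_{C^0}\le\epsilon_0$ the following hold. 1. (First-order expansion of the largest eigenvalue.) With $a(h,\tilde h)=\dfrac{\langle\psi_h,(\mathcal L_{\tilde h}-\mathcal L_h)\psi_h\rangle}{\|\psi_h\|^2}$, $$\big|\mu(\tilde h)-\mu(h)-a(h,\tilde h)\big|\le\frac{8\,\|\Sigma\|_\infty (NC_0)^2\,|h-\tilde h|_{C^0}^2}{\mu(h)-\mu_2(h)},\qquad |a(h,\tilde h)|\le 2\,\|\Sigma\|_\infty^{1/2}NC_0\,|h-\tilde h|_{C^0},$$ and therefore $$|\mu(\tilde h)-\mu(h)|\le 2\,\|\Sigma\|_\infty^{1/2}NC_0\,|h-\tilde h|_{C^0}+\frac{8\,\|\Sigma\|_\infty (NC_0)^2\,|h-\tilde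 h|_{C^0}^2}{\mu(h)-\mu_2(h)} .$$ 2. (Lipschitz bound for the normalized eigenvectors.) $$\|\psi_{\tilde h}-\psi_h\|\le 2\left(\frac{C_0}{\Sigma_0^{1/2}}+\frac{8\,\|\Sigma\|_\infty^{1/2}NC_0}{\mu(h)-\mu_2(h)}\right)|h-\tilde h|_{C^0}\,\|\psi_h\| .$$ -/

import Mathlib

open MeasureTheory Set
open scoped ContDiff ENNReal InnerProductSpace unitInterval

noncomputable section

namespace Neutronics

/-- The real Hilbert space `L²([0,1])`. -/
abbrev L2 : Type := Lp ℝ 2 (volume : Measure I)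

/-- The pairs `(φ, φ')` in `L² × L²`, for `φ` smooth and compactly supported in `(0,1)`. -/
def testPairs : Set (WithLp 2 (L2 × L2)) :=
  {p | ∃ φ : ℝ → ℝ, ContDiff ℝ ∞ φ ∧ HasCompactSupport φ ∧ tsupport φ ⊆ Ioo 0 1 ∧
    (p.fst =ᵐ[volume] fun z : I => φ z) ∧ (p.snd =ᵐ[volume] fun z : I => deriv φ z)}

/-- The Sobolev space `H¹₀(0,1)`: the closure of the test functions for the `H¹` norm. An element
is stored as the pair `(u, u')`, so that the inner product inherited from the `ℓ²`-product
`L² × L²` is the `H¹` inner product `∫ u v + ∫ u' v'`. -/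
def H10 : Submodule ℝ (WithLp 2 (L2 × L2)) :=
  (Submodule.span ℝ testPairs).topologicalClosure

instance : CompleteSpace H10 :=
  inferInstanceAs (CompleteSpace (Submodule.span ℝ testPairs).topologicalClosure)

/-- The inclusion `H¹₀(0,1) → L²([0,1])`. -/
def incl : H10 →L[ℝ] L2 := (WithLp.fstL 2 ℝ L2 L2) ∘L H10.subtypeL

/-- The inverse of `-d²/dz² + 1` from `L²([0,1])` to `H¹₀(0,1) ⊆ L²([0,1])`. Since
`⟪incl† f, v⟫_{H¹} = ⟪f, v⟫_{L²}` for all `v` in `H¹₀`, the element `incl† f` is the weak solution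
`u` in `H¹₀` of `-u'' + u = f`; see `P0inv_weak` and `weak_unique` below. -/
def P0inv : L2 →L[ℝ] L2 := incl ∘L ContinuousLinearMap.adjoint incl

/-- `P0inv f` is a weak solution in `H¹₀` of `-u'' + u = f`. -/
theorem P0inv_weak (f : L2) : ∃ u ∈ H10, u.fst = P0inv f ∧
    ∀ v ∈ H10, ⟪u.snd, v.snd⟫_ℝ + ⟪u.fst, v.fst⟫_ℝ = ⟪f, v.fst⟫_ℝ := by
  refine ⟨(ContinuousLinearMap.adjoint incl f : H10), Subtype.property _, rfl, fun v hv => ?_⟩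
  have h := ContinuousLinearMap.adjoint_inner_left incl (⟨v, hv⟩ : H10) f
  rw [Submodule.coe_inner, WithLp.prod_inner_apply] at h
  rw [add_comm]
  exact h

/-- The weak solution is unique. -/
theorem weak_unique (f : L2) (u : WithLp 2 (L2 × L2)) (hu : u ∈ H10)
    (h : ∀ v ∈ H10, ⟪u.snd, v.snd⟫_ℝ + ⟪u.fst, v.fst⟫_ℝ = ⟪f, v.fst⟫_ℝ) :
    u.fst = P0inv f := by
  have key : (⟨u, hu⟩ : H10) = ContinuousLinearMap.adjoint incl f := by
    refine ext_inner_right ℝ fun v => ?_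
    rw [ContinuousLinearMap.adjoint_inner_left, Submodule.coe_inner, WithLp.prod_inner_apply,
      add_comm]
    exact h v v.2
  change incl ⟨u, hu⟩ = _
  rw [key]
  rfl

/-- The continuous function `z ↦ √Σ(h(z))` on `[0,1]`. -/
def sqrtSigma (Sig : C(ℝ, ℝ)) (h : C(I, ℝ)) : C(I, ℝ) where
  toFun z := √(Sig (h z))
  continuous_toFun := by fun_prop

/-- Multiplication by a continuous function `g`, as a bounded operator on `L²([0,1])`. -/
def mulOp (g : C(I, ℝ)) : L2 →L[ℝ] L2 :=
  (ContinuousLinearMap.mul ℝ ℝ).holderL volume ∞ 2 2 (ContinuousMap.toLp ∞ volume ℝ g)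

/-- `mulOp g` is pointwise multiplication by `g`. -/
theorem mulOp_coe (g : C(I, ℝ)) (f : L2) : mulOp g f =ᵐ[volume] fun z => g z * f z := by
  have h1 := (ContinuousLinearMap.mul ℝ ℝ).coeFn_holder (r := 2)
    (ContinuousMap.toLp ∞ (volume : Measure I) ℝ g) f
  have h2 := ContinuousMap.coeFn_toLp (p := ∞) (𝕜 := ℝ) (volume : Measure I) g
  filter_upwards [h1, h2] with z hz1 hz2
  change ((ContinuousLinearMap.mul ℝ ℝ).holder 2
    (ContinuousMap.toLp ∞ (volume : Measure I) ℝ g) f : I → ℝ) z = _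
  rw [hz1, hz2]
  rfl

/-- The operator `L_h = √Σ(h) (-d²/dz² + 1)⁻¹ √Σ(h)` on `L²([0,1])`. -/
def opL (Sig : C(ℝ, ℝ)) (h : C(I, ℝ)) : L2 →L[ℝ] L2 :=
  mulOp (sqrtSigma Sig h) ∘L P0inv ∘L mulOp (sqrtSigma Sig h)

/-- The `j`-th largest eigenvalue (`j = 1, 2, …`) of an operator on `L²([0,1])`, counted with
multiplicity: the largest eigenvalue `ν` such that the eigenvectors with eigenvalue at least `ν`
span a space of dimension at least `j`. -/
def nthEigenvalue (T : L2 →L[ℝ] L2) (j : ℕ) : ℝ :=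
  sSup {ν | Module.End.HasEigenvalue (T : Module.End ℝ L2) ν ∧
    (j : Cardinal) ≤
      Module.rank ℝ (⨆ ν' ∈ Ici ν, Module.End.eigenspace (T : Module.End ℝ L2) ν' : Submodule ℝ L2)}

/-- `μ(h)`, the largest eigenvalue of `L_h`. -/
def mu (Sig : C(ℝ, ℝ)) (h : C(I, ℝ)) : ℝ := nthEigenvalue (opL Sig h) 1

/-- `μ₂(h)`, the second largest eigenvalue of `L_h`. -/
def mu2 (Sig : C(ℝ, ℝ)) (h : C(I, ℝ)) : ℝ := nthEigenvalue (opL Sig h) 2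

/-- `ψ` is an eigenvector of `L_h` for `μ(h)` with `∫₀¹ √Σ(h(z)) ψ(z) dz = 1`. -/
def IsNormalizedEigenvector (Sig : C(ℝ, ℝ)) (h : C(I, ℝ)) (ψ : L2) : Prop :=
  opL Sig h ψ = mu Sig h • ψ ∧ ∫ z : I, √(Sig (h z)) * ψ z = 1

/-- `‖Σ‖_∞`, the maximum of `|Σ|` over the interval `[-M₀, M₀]` in which `h` takes its values. -/
def supSigma (Sig : C(ℝ, ℝ)) (M₀ : ℝ) : ℝ := ‖Sig.restrict (Icc (-M₀) M₀)‖

end Neutronics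

end

/-!
Write `p = √Σ(h)` and `q = √Σ(k)`; both lie between `m = √Σ₀` and `M = ‖Σ‖_∞^{1/2}`, and `L_h` is the
operator `weightedOp p = p P0inv p`.

*Green function.* A classical solution of the Dirichlet problem is the weak one (`P0inv_toL2`), so
`P0inv` is the integral operator with kernel `green` (`P0inv_eq_kernelOp`). Hence `P0inv` is compact
and preserves positivity, and the two-sided bound
`G(x,x) G(y,y) / sinh 1 ≤ G(x,y) ≤ G(x,x) ≤ 1/4` is available. The eigenfunction `sin (π z)` gives
`‖P0inv‖ ≥ 1/11` (`norm_P0inv_ge`).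

*Spectral gap.* The modulus of a top eigenvector of `L_h` is again a top eigenvector, so there is a
ground state `ψ ≥ 0`. The Green bounds show that `L_h - κ ψ ⊗ ψ` still preserves positivity for an
explicit `κ > 0`; comparing eigenvalues by pairing with `ψ` gives `μ₂(h) ≤ μ(h) - κ ‖ψ‖²`
(`eigenvalue_le_of_orthogonal`). This yields simplicity, uniqueness of the normalized eigenvector,
and a lower bound for the gap in terms of `m` and `M` only, which makes `ε₀` uniform in `B`
(`exists_ground_state`).

*Eigenvalues.* With `E = L_k - L_h` and unit top eigenvectors `v` of `L_h` and `u` of `L_k`, the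
remainder of the first-order expansion is `(⟪u, L_h u⟫ - μ(h)) + ⟪u - v, E (u + v)⟫`. It is at most
`-g s² + 2 ‖E‖ s ≤ ‖E‖² / g`, where `g` is the gap and `s` the sine of the angle between `u` and `v`
(`abs_eigenvalue_sub_le_of_norm_one`); no smallness is needed here.

*Eigenvectors.* Estimating `ψ_k - ψ_h` directly from `‖E‖` would cost a factor `M ‖ψ_h‖`, which the
claim does not allow. Instead `χ = q ψ_k / p` satisfies the normalization for `h` exactly, and
`(μ(k) - L_h) χ = (q² - p²) F / p` with `F = P0inv (q ψ_k)` between `0` and `1/4`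
(`exists_approx_eigenvector`). The resolvent estimate on the complement of `ψ_h`
(`norm_sub_eigenvector_le`) then bounds `χ - ψ_h`, and `ψ_k - χ` is pointwise small relative to `χ`.
-/

noncomputable section

namespace Neutronics

/-! ### Compact positive operators on a real Hilbert space -/

section Abstract

variable {E : Type*} [NormedAddCommGroup E] [InnerProductSpace ℝ E]

theorem exists_eigenvector_norm [CompleteSpace E] [Nontrivial E] {T : E →L[ℝ] E}
    (hc : IsCompactOperator T) (hs : T.IsSymmetric) (hp : ∀ x, 0 ≤ ⟪x, T x⟫_ℝ) :
    ∃ x, x ≠ 0 ∧ T x = ‖T‖ • x := by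
  by_cases h0 : T = 0
  · obtain ⟨x, hx⟩ := exists_ne (0 : E)
    exact ⟨x, hx, by simp [h0]⟩
  have hmem : ‖T‖ ∈ spectrum ℝ T := by
    by_contra hres
    obtain ⟨ε, hε, hle⟩ := T.rayleighQuotient_le_of_norm_mem_resolventSet (𝕜 := ℝ)
      (by simpa [spectrum] using hres)
    have h1 := T.norm_eq_iSup_rayleighQuotient (𝕜 := ℝ) hs
    have h2 : (⨆ x, |T.rayleighQuotient x|) ≤ ‖T‖ - ε := by
      refine ciSup_le fun x => ?_
      rw [abs_of_nonneg]
      · exact hle x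
      · refine div_nonneg ?_ (sq_nonneg _)
        simpa [ContinuousLinearMap.reApplyInnerSelf_apply, real_inner_comm] using hp x
    linarith
  rw [← hc.hasEigenvalue_iff_mem_spectrum (norm_ne_zero_iff.mpr h0)] at hmem
  obtain ⟨x, hx⟩ := hmem.exists_hasEigenvector
  exact ⟨x, hx.2, hx.apply_eq_smul⟩

/-- Removing an eigenvector `ψ` from a compact positive operator leaves a compact positive operator
on the orthogonal complement, whose top eigenvalue bounds the quadratic form there. -/
theorem exists_eigenvector_orthogonal [CompleteSpace E] {T : E →L[ℝ] E}
    (hc : IsCompactOperator T) (hs : T.IsSymmetric) (hp : ∀ x, 0 ≤ ⟪x, T x⟫_ℝ)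
    {ψ : E} {μ : ℝ} (hψ : T ψ = μ • ψ) (hne : ∃ y : E, y ≠ 0 ∧ ⟪ψ, y⟫_ℝ = 0) :
    ∃ (l : ℝ) (χ : E), χ ≠ 0 ∧ ⟪ψ, χ⟫_ℝ = 0 ∧ T χ = l • χ ∧
      ∀ x, ⟪ψ, x⟫_ℝ = 0 → ⟪x, T x⟫_ℝ ≤ l * ‖x‖ ^ 2 := by
  set V : Submodule ℝ E := (ℝ ∙ ψ)ᗮ with hV
  have hmem : ∀ x, x ∈ V ↔ ⟪ψ, x⟫_ℝ = 0 := fun x => Submodule.mem_orthogonal_singleton_iff_inner_right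
  have hinv : ∀ x ∈ V, T x ∈ V := by
    intro x hx
    rw [hmem] at hx ⊢
    have h := hs ψ x
    simp only [ContinuousLinearMap.coe_coe] at h
    rw [← h, hψ, real_inner_smul_left, hx, mul_zero]
  let S : V →L[ℝ] V := T.restrict hinv
  have hScoe : ∀ x : V, ((S x : V) : E) = T x := fun x => rfl
  have hSc : IsCompactOperator S := hc.restrict' hinv
  have hSs : S.IsSymmetric := hs.restrict_invariant hinv
  have hSp : ∀ x, 0 ≤ ⟪x, S x⟫_ℝ := fun x => hp x
  obtain ⟨y, hy0, hy⟩ := hne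
  have : Nontrivial V := ⟨⟨⟨y, (hmem y).2 hy⟩, 0, fun h => hy0 (congrArg Subtype.val h)⟩⟩
  obtain ⟨χ, hχ0, hχ⟩ := exists_eigenvector_norm hSc hSs hSp
  refine ⟨‖S‖, χ, by simpa using hχ0, (hmem _).1 χ.2, ?_, fun x hx => ?_⟩
  · rw [← hScoe, hχ]; rfl
  · have h1 : ⟪(⟨x, (hmem x).2 hx⟩ : V), S ⟨x, (hmem x).2 hx⟩⟫_ℝ
        ≤ ‖(⟨x, (hmem x).2 hx⟩ : V)‖ * ‖S ⟨x, (hmem x).2 hx⟩‖ := real_inner_le_norm _ _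
    have h2 := S.le_opNorm (⟨x, (hmem x).2 hx⟩ : V)
    have h3 : ‖(⟨x, (hmem x).2 hx⟩ : V)‖ = ‖x‖ := rfl
    have h4 : ⟪(⟨x, (hmem x).2 hx⟩ : V), S ⟨x, (hmem x).2 hx⟩⟫_ℝ = ⟪x, T x⟫_ℝ := rfl
    rw [h4, h3] at h1
    rw [h3] at h2
    nlinarith [norm_nonneg x]

/-- A vector at which the quadratic form of a symmetric operator reaches the operator norm is an
eigenvector. -/
theorem eq_norm_smul_of_le_inner {T : E →L[ℝ] E} {x : E}
    (h : ‖T‖ * ‖x‖ ^ 2 ≤ ⟪x, T x⟫_ℝ) : T x = ‖T‖ • x := by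
  have h1 : ‖T x - ‖T‖ • x‖ ^ 2 ≤ 0 := by
    rw [norm_sub_sq_real, real_inner_smul_right, norm_smul, norm_norm, real_inner_comm]
    have h2 := T.le_opNorm x
    have h3 : ‖T x‖ ^ 2 ≤ (‖T‖ * ‖x‖) ^ 2 := by gcongr
    nlinarith [mul_le_mul_of_nonneg_left h (norm_nonneg T)]
  have h2 : ‖T x - ‖T‖ • x‖ = 0 := by nlinarith [norm_nonneg (T x - ‖T‖ • x)]
  exact sub_eq_zero.mp (norm_eq_zero.mp h2)

/-- Decomposing a vector along an eigenvector `ψ` and its complement, where the quadratic form is at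
most `l`. -/
theorem inner_apply_le_of_orthogonal {T : E →L[ℝ] E} (hs : T.IsSymmetric) {ψ : E} {μ l : ℝ}
    (hψ : T ψ = μ • ψ) (hn : ‖ψ‖ = 1)
    (hl : ∀ x, ⟪ψ, x⟫_ℝ = 0 → ⟪x, T x⟫_ℝ ≤ l * ‖x‖ ^ 2) (u : E) :
    ⟪u, T u⟫_ℝ ≤ μ * ⟪ψ, u⟫_ℝ ^ 2 + l * (‖u‖ ^ 2 - ⟪ψ, u⟫_ℝ ^ 2) := by
  set c := ⟪ψ, u⟫_ℝ with hc
  have hψψ : ⟪ψ, ψ⟫_ℝ = 1 := by rw [real_inner_self_eq_norm_sq, hn]; norm_num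
  have hy : ⟪ψ, u - c • ψ⟫_ℝ = 0 := by
    rw [inner_sub_right, real_inner_smul_right, hψψ, ← hc]; ring
  have h1 := hl _ hy
  have h2 : ⟪ψ, T u⟫_ℝ = μ * c := by
    have := hs ψ u
    simp only [ContinuousLinearMap.coe_coe] at this
    rw [← this, hψ, real_inner_smul_left]
  have h3 : ‖u - c • ψ‖ ^ 2 = ‖u‖ ^ 2 - c ^ 2 := by
    rw [norm_sub_sq_real, real_inner_smul_right, norm_smul, hn, real_inner_comm, ← hc, mul_one,
      Real.norm_eq_abs, sq_abs]
    ring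
  have h4 : ⟪u - c • ψ, T (u - c • ψ)⟫_ℝ = ⟪u, T u⟫_ℝ - μ * c ^ 2 := by
    rw [map_sub, map_smul, hψ]
    simp only [inner_sub_left, inner_sub_right, real_inner_smul_left, real_inner_smul_right, h2,
      hψψ, real_inner_comm ψ u, ← hc]
    ring
  rw [h3, h4] at h1
  linarith

/-- Second-order control of a perturbed top eigenvalue, for unit eigenvectors. Writing
`E = T' - T`, the remainder is `(⟪u, T u⟫ - μ) + ⟪u - v, E (u + v)⟫`; with `s` the sine of the
angle between `u` and `v`, this is at most `-g s² + 2 ‖E‖ s ≤ ‖E‖² / g`. -/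
theorem abs_eigenvalue_sub_le_of_norm_one {T T' : E →L[ℝ] E} (hs : T.IsSymmetric)
    (hs' : T'.IsSymmetric) {v u : E} {μ μ' l e : ℝ} (hv : T v = μ • v) (hv1 : ‖v‖ = 1)
    (hu : T' u = μ' • u) (hu1 : ‖u‖ = 1) (hmax : ∀ x, ⟪x, T' x⟫_ℝ ≤ μ' * ‖x‖ ^ 2)
    (hl : ∀ x, ⟪v, x⟫_ℝ = 0 → ⟪x, T x⟫_ℝ ≤ l * ‖x‖ ^ 2) (hgap : l < μ) (he : ‖T' - T‖ ≤ e) :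
    |μ' - μ - ⟪v, (T' - T) v⟫_ℝ| ≤ e ^ 2 / (μ - l) := by
  set D := T' - T with hD
  have hsD : ∀ x y, ⟪D x, y⟫_ℝ = ⟪x, D y⟫_ℝ := by
    intro x y
    have h1 := hs x y
    have h2 := hs' x y
    simp only [ContinuousLinearMap.coe_coe] at h1 h2
    simp only [hD, _root_.sub_apply, inner_sub_left, inner_sub_right, h1, h2]
  have hvv : ⟪v, v⟫_ℝ = 1 := by rw [real_inner_self_eq_norm_sq, hv1]; norm_num
  have huu : ⟪u, u⟫_ℝ = 1 := by rw [real_inner_self_eq_norm_sq, hu1]; norm_num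
  set c := ⟪v, u⟫_ℝ with hc
  have hlow : 0 ≤ μ' - μ - ⟪v, D v⟫_ℝ := by
    have h := hmax v
    have : ⟪v, T' v⟫_ℝ = ⟪v, D v⟫_ℝ + μ := by
      simp [hD, hv, inner_sub_right, real_inner_smul_right, hv1]
    rw [this, hv1] at h
    linarith
  have h1 := inner_apply_le_of_orthogonal hs hv hv1 hl u
  rw [← hc, hu1] at h1
  have h2 : μ' = ⟪u, T u⟫_ℝ + ⟪u, D u⟫_ℝ := by
    simp [hD, hu, inner_sub_right, real_inner_smul_right, hu1]
  have h3 : ⟪u, D u⟫_ℝ - ⟪v, D v⟫_ℝ = ⟪u - v, D (u + v)⟫_ℝ := by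
    rw [map_add]
    simp only [inner_sub_left, inner_add_right]
    rw [← hsD v u, real_inner_comm u (D v)]
    ring
  set b := ‖u - v‖ * ‖u + v‖ with hb
  have hb0 : 0 ≤ b := by positivity
  have h4 : ⟪u - v, D (u + v)⟫_ℝ ≤ e * b := by
    have h41 := real_inner_le_norm (u - v) (D (u + v))
    have h42 := D.le_of_opNorm_le he (u + v)
    have h43 := mul_le_mul_of_nonneg_left h42 (norm_nonneg (u - v))
    rw [hb]
    linarith
  have h5 : b ^ 2 = 4 * (1 - c ^ 2) := by
    rw [hb, mul_pow, norm_sub_sq_real, norm_add_sq_real, hu1, hv1, real_inner_comm, ← hc]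
    ring
  have hg : 0 < μ - l := by linarith
  rw [abs_of_nonneg hlow, le_div_iff₀ hg]
  have h6 : μ' - μ - ⟪v, D v⟫_ℝ ≤ e * b - (μ - l) * b ^ 2 / 4 := by
    rw [h5]
    linarith
  have h7 := mul_le_mul_of_nonneg_right h6 hg.le
  nlinarith [sq_nonneg (e - (μ - l) * b / 2)]

theorem abs_eigenvalue_sub_le {T T' : E →L[ℝ] E} (hs : T.IsSymmetric)
    (hs' : T'.IsSymmetric) {v u : E} {μ μ' l e : ℝ} (hv : T v = μ • v) (hv0 : v ≠ 0)
    (hu : T' u = μ' • u) (hu0 : u ≠ 0) (hmax : ∀ x, ⟪x, T' x⟫_ℝ ≤ μ' * ‖x‖ ^ 2)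
    (hl : ∀ x, ⟪v, x⟫_ℝ = 0 → ⟪x, T x⟫_ℝ ≤ l * ‖x‖ ^ 2) (hgap : l < μ) (he : ‖T' - T‖ ≤ e) :
    |μ' - μ - ⟪v, (T' - T) v⟫_ℝ / ‖v‖ ^ 2| ≤ e ^ 2 / (μ - l) := by
  have hvn : ‖v‖ ≠ 0 := norm_ne_zero_iff.mpr hv0
  have h := abs_eigenvalue_sub_le_of_norm_one (v := ‖v‖⁻¹ • v) (u := ‖u‖⁻¹ • u) hs hs'
    (by rw [map_smul, hv, smul_comm]) (norm_smul_inv_norm (𝕜 := ℝ) hv0)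
    (by rw [map_smul, hu, smul_comm]) (norm_smul_inv_norm (𝕜 := ℝ) hu0) hmax
    (fun x hx => hl x (by
      rw [real_inner_smul_left] at hx
      exact (mul_eq_zero.mp hx).resolve_left (inv_ne_zero hvn))) hgap he
  rw [map_smul, real_inner_smul_left, real_inner_smul_right] at h
  convert h using 3
  field_simp

/-- Resolvent estimate off the top eigenvector, with the normalization `⟪p, ·⟫ = 1` shared by `χ`
and `ψ`. -/
theorem norm_sub_eigenvector_le {T : E →L[ℝ] E} {ψ χ p : E} {μ ν l : ℝ}
    (hψ : T ψ = μ • ψ) (hl : ∀ x, ⟪ψ, x⟫_ℝ = 0 → ⟪x, T x⟫_ℝ ≤ l * ‖x‖ ^ 2) (hν : l < ν)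
    (hpψ : ⟪p, ψ⟫_ℝ = 1) (hpχ : ⟪p, χ⟫_ℝ = 1) :
    ‖χ - ψ‖ ≤ 2 * ‖p‖ * (‖ν • χ - T χ‖ / (ν - l)) * ‖ψ‖ := by
  have hψ0 : ψ ≠ 0 := fun h => by simp [h] at hpψ
  have hn : ‖ψ‖ ^ 2 ≠ 0 := by simpa using hψ0
  set a := ⟪ψ, χ⟫_ℝ / ‖ψ‖ ^ 2 with ha
  set w := χ - a • ψ with hw
  set ξ := ν • χ - T χ with hξ
  have hψw : ⟪ψ, w⟫_ℝ = 0 := by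
    rw [hw, inner_sub_right, real_inner_smul_right, real_inner_self_eq_norm_sq, ha]
    field_simp
    ring
  have hg : 0 < ν - l := by linarith
  have h1 : ν • w - T w = ξ - (a * (ν - μ)) • ψ := by
    rw [hξ, hw, map_sub, map_smul, hψ]
    module
  have h2 : ⟪w, ν • w - T w⟫_ℝ = ⟪w, ξ⟫_ℝ := by
    rw [h1, inner_sub_right, real_inner_smul_right, real_inner_comm ψ w, hψw]
    ring
  have h3 : (ν - l) * ‖w‖ ^ 2 ≤ ‖w‖ * ‖ξ‖ := by
    have h31 := hl w hψw
    have h32 := real_inner_le_norm w ξ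
    rw [← h2, inner_sub_right, real_inner_smul_right, real_inner_self_eq_norm_sq] at h32
    linarith
  have h4 : ‖w‖ ≤ ‖ξ‖ / (ν - l) := by
    rw [le_div_iff₀ hg]
    rcases eq_or_lt_of_le (norm_nonneg w) with h0 | h0
    · rw [← h0]; simp
    · nlinarith
  have h5 : χ - ψ = w - ⟪p, w⟫_ℝ • ψ := by
    have : ⟪p, w⟫_ℝ = 1 - a := by
      rw [hw, inner_sub_right, real_inner_smul_right, hpψ, hpχ]; ring
    rw [this, hw]
    module
  have h6 : 1 ≤ ‖p‖ * ‖ψ‖ := hpψ ▸ real_inner_le_norm p ψ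
  have h7 : ‖⟪p, w⟫_ℝ‖ ≤ ‖p‖ * ‖w‖ := norm_inner_le_norm p w
  calc ‖χ - ψ‖ ≤ ‖w‖ + ‖⟪p, w⟫_ℝ‖ * ‖ψ‖ := by
        rw [h5, ← norm_smul]; exact norm_sub_le _ _
    _ ≤ 2 * ‖p‖ * ‖w‖ * ‖ψ‖ := by
        nlinarith [mul_le_mul_of_nonneg_right h7 (norm_nonneg ψ),
          mul_le_mul_of_nonneg_right h6 (norm_nonneg w)]
    _ ≤ 2 * ‖p‖ * (‖ξ‖ / (ν - l)) * ‖ψ‖ := by gcongr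

end Abstract

/-! ### Continuous functions in `L²([0,1])` and kernel operators -/

/-- The class in `L²([0,1])` of a continuous function on `[0,1]`. -/
def toL2 (g : C(I, ℝ)) : L2 := ContinuousMap.toLp 2 volume ℝ g

theorem toL2_coe (g : C(I, ℝ)) : toL2 g =ᵐ[volume] g := ContinuousMap.coeFn_toLp volume g

/-- The restriction to `[0,1]` of a continuous function on the line. -/
def restrictI (F : ℝ → ℝ) (hF : Continuous F) : C(I, ℝ) := ⟨fun z => F z, by fun_prop⟩

theorem restrictI_apply (F : ℝ → ℝ) (hF : Continuous F) (z : I) : restrictI F hF z = F z := rfl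

theorem norm_toL2_le (g : C(I, ℝ)) : ‖toL2 g‖ ≤ ‖g‖ := by
  refine (Lp.norm_le_of_ae_bound (norm_nonneg g) (C := ‖g‖) ?_).trans ?_
  · filter_upwards [toL2_coe g] with z hz
    rw [hz]
    exact g.norm_coe_le_norm z
  · simp [measureUnivNNReal]

theorem integral_unitInterval_eq (F : ℝ → ℝ) : ∫ z : I, F z = ∫ x in (0 : ℝ)..1, F x := by
  rw [integral_subtype measurableSet_Icc, integral_Icc_eq_integral_Ioc,
    intervalIntegral.integral_of_le zero_le_one]

theorem setIntegral_Iic_eq (F : ℝ → ℝ) (x : I) :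
    ∫ z : I in Iic x, F z = ∫ t in (0 : ℝ)..x, F t := by
  have h1 : ∀ z : I, (Iic x).indicator (fun z : I => F z) z = (Iic (x : ℝ)).indicator F z := by
    intro z
    simp only [indicator, mem_Iic, Subtype.coe_le_coe]
  rw [← integral_indicator measurableSet_Iic, integral_congr_ae (Filter.Eventually.of_forall h1),
    integral_subtype measurableSet_Icc ((Iic (x : ℝ)).indicator F),
    setIntegral_indicator measurableSet_Iic, intervalIntegral.integral_of_le x.2.1,
    ← integral_Icc_eq_integral_Ioc]
  congr 2
  ext t
  simp only [mem_inter_iff, mem_Icc, mem_Iic]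
  exact ⟨fun h => ⟨h.1.1, h.2⟩, fun h => ⟨⟨h.1, h.2.trans x.2.2⟩, h.2⟩⟩

theorem inner_L2_eq (f g : L2) : ⟪f, g⟫_ℝ = ∫ z : I, f z * g z := by
  rw [MeasureTheory.L2.inner_def]
  refine integral_congr_ae (Filter.Eventually.of_forall fun z => ?_)
  simp [mul_comm]

theorem integrable_mul_L2 (f g : L2) : Integrable (fun z : I => f z * g z) := by
  have h := MeasureTheory.L2.integrable_inner (𝕜 := ℝ) f g
  refine h.congr (Filter.Eventually.of_forall fun z => ?_)
  simp [mul_comm]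

theorem inner_toL2_left (g : C(I, ℝ)) (f : L2) : ⟪toL2 g, f⟫_ℝ = ∫ z : I, g z * f z := by
  rw [inner_L2_eq]
  refine integral_congr_ae ?_
  filter_upwards [toL2_coe g] with z hz
  rw [hz]

theorem integrable_toL2_mul (g : C(I, ℝ)) (f : L2) : Integrable (fun z : I => g z * f z) := by
  refine (integrable_mul_L2 (toL2 g) f).congr ?_
  filter_upwards [toL2_coe g] with z hz
  rw [hz]

theorem inner_toL2_toL2 (g k : C(I, ℝ)) : ⟪toL2 g, toL2 k⟫_ℝ = ∫ z : I, g z * k z := by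
  rw [inner_toL2_left]
  refine integral_congr_ae ?_
  filter_upwards [toL2_coe k] with z hz
  rw [hz]

/-- The continuous function `x ↦ ⟪κ x, f⟫`, the value at `f` of the integral operator with
kernel `κ`. -/
def kernelFun (κ : C(I, L2)) (f : L2) : C(I, ℝ) := ⟨fun x => ⟪κ x, f⟫_ℝ, by fun_prop⟩

theorem kernelFun_apply (κ : C(I, L2)) (f : L2) (x : I) : kernelFun κ f x = ⟪κ x, f⟫_ℝ := rfl

theorem norm_kernelFun_le (κ : C(I, L2)) (f : L2) : ‖kernelFun κ f‖ ≤ ‖κ‖ * ‖f‖ := by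
  refine (ContinuousMap.norm_le _ (by positivity)).2 fun x => ?_
  rw [kernelFun_apply]
  exact (norm_inner_le_norm _ _).trans (by gcongr; exact κ.norm_coe_le_norm x)

/-- The integral operator `f ↦ (x ↦ ⟪κ x, f⟫)` on `L²([0,1])` with an `L²`-continuous kernel. -/
def kernelOp (κ : C(I, L2)) : L2 →L[ℝ] L2 :=
  LinearMap.mkContinuous
    { toFun := fun f => toL2 (kernelFun κ f)
      map_add' := fun f g => by
        rw [toL2, toL2, toL2, ← map_add]
        congr 1
        ext x
        simp [kernelFun_apply, inner_add_right]
      map_smul' := fun c f => by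
        rw [toL2, toL2, ← map_smul]
        congr 1
        ext x
        simp [kernelFun_apply, real_inner_smul_right] } ‖κ‖
    fun f => (norm_toL2_le _).trans (norm_kernelFun_le κ f)

theorem kernelOp_apply (κ : C(I, L2)) (f : L2) : kernelOp κ f = toL2 (kernelFun κ f) := rfl

/-- The images of the unit ball are equicontinuous, so this is the Arzelà–Ascoli theorem. -/
theorem isCompactOperator_kernelOp (κ : C(I, L2)) : IsCompactOperator (kernelOp κ) := by
  let b : L2 → BoundedContinuousFunction I ℝ :=
    fun f => BoundedContinuousFunction.mkOfCompact (kernelFun κ f)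
  let A : Set (BoundedContinuousFunction I ℝ) := b '' Metric.closedBall 0 1
  have hA : IsCompact (closure A) := by
    refine BoundedContinuousFunction.arzela_ascoli (Metric.closedBall 0 ‖κ‖)
      (isCompact_closedBall 0 ‖κ‖) A ?_ ?_
    · rintro _ x ⟨f, hf, rfl⟩
      rw [mem_closedBall_zero_iff] at hf ⊢
      calc ‖b f x‖ ≤ ‖kernelFun κ f‖ := (kernelFun κ f).norm_coe_le_norm x
        _ ≤ ‖κ‖ * ‖f‖ := norm_kernelFun_le κ f
        _ ≤ ‖κ‖ := mul_le_of_le_one_right (norm_nonneg _) hf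
    · intro x
      rw [Metric.equicontinuousAt_iff]
      intro ε hε
      obtain ⟨δ, hδ, h⟩ := Metric.continuousAt_iff.1 κ.continuous.continuousAt ε hε
      refine ⟨δ, hδ, fun y hy => ?_⟩
      rintro ⟨_, f, hf, rfl⟩
      rw [mem_closedBall_zero_iff] at hf
      have h1 := h hy
      rw [dist_comm, dist_eq_norm] at h1
      rw [dist_eq_norm]
      have h2 : b f x - b f y = ⟪κ x - κ y, f⟫_ℝ := by
        rw [inner_sub_left]; rfl
      have h3 := norm_inner_le_norm (𝕜 := ℝ) (κ x - κ y) f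
      calc ‖b f x - b f y‖ = ‖⟪κ x - κ y, f⟫_ℝ‖ := by rw [h2]
        _ ≤ ‖κ x - κ y‖ * ‖f‖ := h3
        _ ≤ ‖κ x - κ y‖ := mul_le_of_le_one_right (norm_nonneg _) hf
        _ < ε := h1
  let L : BoundedContinuousFunction I ℝ →L[ℝ] L2 := BoundedContinuousFunction.toLp 2 volume ℝ
  refine ⟨L '' closure A, hA.image L.continuous, Filter.mem_of_superset
    (Metric.closedBall_mem_nhds 0 one_pos) fun f hf => ⟨b f, subset_closure ⟨f, hf, rfl⟩, rfl⟩⟩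

/-- The indicator functions of `[0,x]`, the kernel of integration from `0`. -/
def volterraKernel : C(I, L2) where
  toFun x := indicatorConstLp 2 (s := Iic x) measurableSet_Iic (measure_ne_top _ _) 1
  continuous_toFun := by
    refine continuous_indicatorConstLp_set (by simp) fun x => ?_
    have h1 : ∀ y : I, volume (symmDiff (Iic y) (Iic x)) ≤ edist y x := by
      intro y
      rw [← unitInterval.volume_uIcc]
      refine measure_mono fun z hz => ?_
      rcases hz with ⟨h, h'⟩ | ⟨h, h'⟩
      · exact ⟨inf_le_left.trans (not_le.1 h').le, le_sup_of_le_right h⟩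
      · exact ⟨inf_le_right.trans (not_le.1 h').le, le_sup_of_le_left h⟩
    refine tendsto_of_tendsto_of_tendsto_of_le_of_le tendsto_const_nhds ?_ (fun _ => zero_le) h1
    exact tendsto_iff_edist_tendsto_0.1 Filter.tendsto_id

theorem kernelFun_volterra (f : L2) (F : ℝ → ℝ) (hF : f =ᵐ[volume] fun z : I => F z) (x : I) :
    kernelFun volterraKernel f x = ∫ t in (0 : ℝ)..x, F t := by
  rw [kernelFun_apply, ← setIntegral_Iic_eq]
  change ⟪indicatorConstLp 2 (s := Iic x) measurableSet_Iic (measure_ne_top _ _) (1 : ℝ), f⟫_ℝ = _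
  rw [MeasureTheory.L2.inner_indicatorConstLp_one]
  exact integral_congr_ae (ae_restrict_of_ae hF)

/-! ### Classical solutions are weak solutions -/

/-- The test functions on `(0,1)`, as elements of `L²([0,1])`. -/
def testFunctions : Set L2 :=
  {f | ∃ φ : ℝ → ℝ, ContDiff ℝ ∞ φ ∧ HasCompactSupport φ ∧ tsupport φ ⊆ Ioo 0 1 ∧
    f =ᵐ[volume] fun z : I => φ z}

theorem closure_span_testFunctions : (Submodule.span ℝ testFunctions).topologicalClosure = ⊤ := by
  rw [Submodule.topologicalClosure_eq_top_iff, Submodule.eq_bot_iff]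
  intro a ha
  rw [Submodule.mem_orthogonal] at ha
  set f : ℝ → ℝ := Function.extend Subtype.val a 0 with hf
  have hfa : ∀ z : I, f z = a z := fun z => Subtype.val_injective.extend_apply _ _ _
  have hae : Integrable (fun z : I => f z) := by
    simp only [hfa]
    exact (Lp.memLp a).integrable (by norm_num)
  have hint : IntegrableOn f (Icc 0 1) :=
    (unitInterval.measurePreserving_coe.integrable_comp_emb
      unitInterval.measurableEmbedding_coe).1 hae
  have h0 : ∀ᵐ x, x ∈ Ioo (0 : ℝ) 1 → f x = 0 := by
    refine isOpen_Ioo.ae_eq_zero_of_integral_contDiff_smul_eq_zero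
      (hint.mono_set Ioo_subset_Icc_self).locallyIntegrableOn fun φ hφ hc hsupp => ?_
    have h1 : ∫ x, φ x • f x = ∫ x in Icc (0 : ℝ) 1, φ x • f x := by
      refine (setIntegral_eq_integral_of_forall_compl_eq_zero fun x hx => ?_).symm
      have : φ x = 0 := by
        by_contra h
        exact hx (Ioo_subset_Icc_self (hsupp (subset_tsupport _ h)))
      simp [this]
    rw [h1, ← integral_subtype measurableSet_Icc (fun x => φ x • f x)]
    have h2 := ha (toL2 (restrictI φ hφ.continuous))
      (Submodule.subset_span ⟨φ, hφ, hc, hsupp, toL2_coe _⟩)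
    rw [inner_toL2_left] at h2
    simpa only [hfa, smul_eq_mul, restrictI_apply] using h2
  have h3 : ∀ᵐ x ∂(volume.restrict (Icc (0 : ℝ) 1)), f x = 0 := by
    rw [← restrict_Ioo_eq_restrict_Icc]
    exact (ae_restrict_iff' measurableSet_Ioo).2 h0
  have h4 : ∀ᵐ z : I, f z = 0 :=
    unitInterval.measurePreserving_coe.quasiMeasurePreserving.ae h3
  rw [Lp.eq_zero_iff_ae_eq_zero]
  filter_upwards [h4] with z hz
  rw [← hfa, hz, Pi.zero_apply]

/-- A mean-zero test function on `(0,1)` is the derivative of a test function. -/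
theorem exists_primitive_test {ρ : ℝ → ℝ} (hρ : ContDiff ℝ ∞ ρ) (hc : HasCompactSupport ρ)
    (hs : tsupport ρ ⊆ Ioo 0 1) (h0 : ∫ x in (0 : ℝ)..1, ρ x = 0) :
    let R : ℝ → ℝ := fun x => ∫ t in (0 : ℝ)..x, ρ t
    ContDiff ℝ ∞ R ∧ HasCompactSupport R ∧ tsupport R ⊆ Ioo 0 1 ∧ deriv R = ρ := by
  intro R
  have hd : ∀ x, HasDerivAt R (ρ x) x := fun x =>
    intervalIntegral.integral_hasDerivAt_right (hρ.continuous.intervalIntegrable _ _)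
      (hρ.continuous.stronglyMeasurableAtFilter _ _) hρ.continuous.continuousAt
  have hdR : deriv R = ρ := funext fun x => (hd x).deriv
  have hC : ContDiff ℝ ∞ R := by
    rw [contDiff_infty_iff_deriv, hdR]
    exact ⟨fun x => (hd x).differentiableAt, hρ⟩
  set K : Set ℝ := insert (1 / 2) (tsupport ρ) with hK
  have hKc : IsCompact K := hc.isCompact.insert _
  have hKn : K.Nonempty := ⟨1 / 2, mem_insert _ _⟩
  have hKs : K ⊆ Ioo 0 1 := insert_subset (by norm_num) hs
  have ha := hKs (hKc.sInf_mem hKn)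
  have hb := hKs (hKc.sSup_mem hKn)
  set a := sInf K
  set b := sSup K
  have hz : ∀ t, t ∉ Icc a b → ρ t = 0 := by
    intro t ht
    by_contra h
    have : t ∈ K := mem_insert_of_mem _ (subset_tsupport _ h)
    exact ht ⟨csInf_le hKc.bddBelow this, le_csSup hKc.bddAbove this⟩
  have hzero : ∀ c d : ℝ, (∀ t ∈ uIcc c d, t ∉ Icc a b) → ∫ t in c..d, ρ t = 0 := by
    intro c d h
    rw [intervalIntegral.integral_congr (g := fun _ => 0) fun t ht => hz t (h t ht)]
    simp
  have hsub : Function.support R ⊆ Icc a b := by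
    intro x hx
    by_contra hxn
    rw [mem_Icc, not_and_or, not_le, not_le] at hxn
    refine hx ?_
    rcases hxn with h | h
    · refine hzero 0 x fun t ht hab => ?_
      have := (mem_uIcc.1 ht)
      rcases this with h' | h' <;> linarith [hab.1, ha.1]
    · have h1 : ∫ t in x..1, ρ t = 0 := by
        refine hzero x 1 fun t ht hab => ?_
        rcases (mem_uIcc.1 ht) with h' | h' <;> linarith [hab.2, hb.2]
      have h2 := intervalIntegral.integral_add_adjacent_intervals (μ := volume)
        (hρ.continuous.intervalIntegrable 0 x) (hρ.continuous.intervalIntegrable x 1)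
      rw [h1, h0, add_zero] at h2
      exact h2
  have hts : tsupport R ⊆ Icc a b := closure_minimal hsub isClosed_Icc
  refine ⟨hC, HasCompactSupport.of_support_subset_isCompact isCompact_Icc hsub,
    fun x hx => ?_, hdR⟩
  have := hts hx
  exact ⟨ha.1.trans_le this.1, this.2.trans_lt hb.2⟩

theorem exists_test_integral_one : ∃ η : ℝ → ℝ, ContDiff ℝ ∞ η ∧ HasCompactSupport η ∧
    tsupport η ⊆ Ioo 0 1 ∧ ∫ x in (0 : ℝ)..1, η x = 1 := by
  let f : ContDiffBump (1 / 2 : ℝ) := ⟨1 / 8, 1 / 4, by norm_num, by norm_num⟩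
  have hs : tsupport (f.normed volume) ⊆ Ioo 0 1 := by
    rw [f.tsupport_normed_eq, Real.closedBall_eq_Icc]
    intro x hx
    have h1 : f.rOut = 1 / 4 := rfl
    rw [h1] at hx
    constructor <;> linarith [hx.1, hx.2]
  refine ⟨f.normed volume, f.contDiff_normed, f.hasCompactSupport_normed, hs, ?_⟩
  rw [intervalIntegral.integral_eq_integral_of_support_subset
    ((subset_tsupport _).trans (hs.trans Ioo_subset_Ioc_self)), f.integral_normed]

/-- A `C¹` function vanishing at both ends of `[0,1]` belongs to `H¹₀(0,1)`. Its derivative is a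
limit in `L²` of test functions, which a multiple of a fixed bump `η` turns into mean-zero ones;
the primitives of these are test functions and converge in `H¹`. -/
theorem pair_mem_H10 {u u' : ℝ → ℝ} (hu : ∀ x, HasDerivAt u (u' x) x) (hu' : Continuous u')
    (h0 : u 0 = 0) (h1 : u 1 = 0) :
    WithLp.toLp 2 (toL2 (restrictI u (continuous_iff_continuousAt.2 fun x => (hu x).continuousAt)),
      toL2 (restrictI u' hu')) ∈ H10 := by
  obtain ⟨η, hη, hηc, hηs, hη1⟩ := exists_test_integral_one
  set e : L2 := toL2 (restrictI η hη.continuous) with he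
  let one : L2 := toL2 (1 : C(I, ℝ))
  let B : L2 →L[ℝ] L2 := ContinuousLinearMap.id ℝ L2 - (innerSL ℝ one).smulRight e
  let Φ : L2 →L[ℝ] WithLp 2 (L2 × L2) :=
    ((WithLp.prodContinuousLinearEquiv 2 ℝ L2 L2).symm : (L2 × L2) →L[ℝ] WithLp 2 (L2 × L2)) ∘L
      ((kernelOp volterraKernel ∘L B).prod B)
  have hB : ∀ (f : L2) (F : ℝ → ℝ), (f =ᵐ[volume] fun z : I => F z) →
      B f =ᵐ[volume] fun z : I => F z - (∫ x in (0 : ℝ)..1, F x) * η z := by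
    intro f F hF
    have hBf : B f = f - (∫ x in (0 : ℝ)..1, F x) • e := by
      have : ⟪one, f⟫_ℝ = ∫ x in (0 : ℝ)..1, F x := by
        rw [inner_toL2_left, ← integral_unitInterval_eq]
        refine integral_congr_ae ?_
        filter_upwards [hF] with z hz
        simp [hz]
      simp [B, this]
    rw [hBf]
    filter_upwards [hF, toL2_coe (restrictI η hη.continuous), Lp.coeFn_sub f
      ((∫ x in (0 : ℝ)..1, F x) • e), Lp.coeFn_smul (∫ x in (0 : ℝ)..1, F x) e] with z h1 h2 h3 h4
    rw [h3, Pi.sub_apply, h4, h1, Pi.smul_apply, he, h2, smul_eq_mul, restrictI_apply]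
  have hle : Submodule.span ℝ testFunctions ≤ H10.comap (Φ : L2 →ₗ[ℝ] WithLp 2 (L2 × L2)) := by
    refine Submodule.span_le.2 ?_
    rintro f ⟨φ, hφ, hφc, hφs, hf⟩
    refine Submodule.le_topologicalClosure _ (Submodule.subset_span ?_)
    have hm := hB f φ hf
    set c := ∫ x in (0 : ℝ)..1, φ x with hc
    have hρs : tsupport (fun x => φ x - c * η x) ⊆ tsupport φ ∪ tsupport η := by
      refine closure_minimal (fun x hx => ?_) ((isClosed_tsupport _).union (isClosed_tsupport _))
      by_contra hn
      rw [mem_union, not_or] at hn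
      refine hx ?_
      simp [image_eq_zero_of_notMem_tsupport hn.1, image_eq_zero_of_notMem_tsupport hn.2]
    have hcη : Continuous fun x => c * η x := continuous_const.mul hη.continuous
    obtain ⟨p1, p2, p3, p4⟩ := exists_primitive_test (ρ := fun x => φ x - c * η x)
      (hφ.sub (contDiff_const.mul hη))
      (HasCompactSupport.of_support_subset_isCompact (hφc.isCompact.union hηc.isCompact)
        ((subset_tsupport _).trans hρs))
      (hρs.trans (union_subset hφs hηs)) (by
        rw [intervalIntegral.integral_sub (hφ.continuous.intervalIntegrable _ _)
          (hcη.intervalIntegrable _ _),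
          intervalIntegral.integral_const_mul, hη1, hc]
        ring)
    refine ⟨_, p1, p2, p3, ?_, ?_⟩
    · refine (toL2_coe _).trans (Filter.Eventually.of_forall fun z => ?_)
      exact kernelFun_volterra (B f) _ hm z
    · rw [p4]
      exact hm
  have htop : H10.comap (Φ : L2 →ₗ[ℝ] WithLp 2 (L2 × L2)) = ⊤ := by
    rw [eq_top_iff, ← closure_span_testFunctions]
    refine Submodule.topologicalClosure_minimal _ hle ?_
    exact (Submodule.isClosed_topologicalClosure _).preimage Φ.continuous
  have hmem : toL2 (restrictI u' hu') ∈ H10.comap (Φ : L2 →ₗ[ℝ] WithLp 2 (L2 × L2)) := by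
    rw [htop]; trivial
  have hFTC : ∀ x : ℝ, ∫ t in (0 : ℝ)..x, u' t = u x := fun x => by
    rw [intervalIntegral.integral_eq_sub_of_hasDerivAt (fun t _ => hu t)
      (hu'.intervalIntegrable _ _), h0, sub_zero]
  have hBu : B (toL2 (restrictI u' hu')) = toL2 (restrictI u' hu') := by
    refine Lp.ext ?_
    filter_upwards [hB (toL2 (restrictI u' hu')) u' (toL2_coe _),
      toL2_coe (restrictI u' hu')] with z h2 h3
    rw [h2, h3, hFTC, h1, zero_mul, sub_zero, restrictI_apply]
  have hΦ : Φ (toL2 (restrictI u' hu')) = WithLp.toLp 2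
      (kernelOp volterraKernel (B (toL2 (restrictI u' hu'))), B (toL2 (restrictI u' hu'))) := rfl
  have hV : kernelOp volterraKernel (toL2 (restrictI u' hu')) = toL2 (restrictI u
      (continuous_iff_continuousAt.2 fun x => (hu x).continuousAt)) := by
    rw [kernelOp_apply]
    congr 1
    ext x
    rw [kernelFun_volterra _ u' (toL2_coe _), hFTC, restrictI_apply]
  rw [Submodule.mem_comap] at hmem
  change Φ _ ∈ H10 at hmem
  rwa [hΦ, hBu, hV] at hmem

/-- A classical solution of `-u'' + u = F` with Dirichlet conditions is the weak solution. -/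
theorem P0inv_toL2 {u u' F : ℝ → ℝ} (hu : ∀ x, HasDerivAt u (u' x) x)
    (hu' : ∀ x, HasDerivAt u' (u x - F x) x) (hF : Continuous F) (h0 : u 0 = 0) (h1 : u 1 = 0) :
    P0inv (toL2 (restrictI F hF)) =
      toL2 (restrictI u (continuous_iff_continuousAt.2 fun x => (hu x).continuousAt)) := by
  have hcu : Continuous u := continuous_iff_continuousAt.2 fun x => (hu x).continuousAt
  have hcu' : Continuous u' := continuous_iff_continuousAt.2 fun x => (hu' x).continuousAt
  set U := toL2 (restrictI u hcu) with hU
  set U' := toL2 (restrictI u' hcu') with hU'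
  set f := toL2 (restrictI F hF) with hf
  let L : WithLp 2 (L2 × L2) →L[ℝ] ℝ :=
    innerSL ℝ U' ∘L WithLp.sndL 2 ℝ L2 L2 + innerSL ℝ (U - f) ∘L WithLp.fstL 2 ℝ L2 L2
  have hLv : ∀ v, L v = ⟪U', v.snd⟫_ℝ + (⟪U, v.fst⟫_ℝ - ⟪f, v.fst⟫_ℝ) := by
    intro v
    rw [← inner_sub_left]; rfl
  have hker : H10 ≤ LinearMap.ker (L : WithLp 2 (L2 × L2) →ₗ[ℝ] ℝ) := by
    refine Submodule.topologicalClosure_minimal _ (Submodule.span_le.2 ?_) L.isClosed_ker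
    rintro v ⟨φ, hφ, hφc, hφs, hv1, hv2⟩
    change L v = 0
    have hdφ : Continuous (deriv φ) := hφ.continuous_deriv (by simp)
    have e1 : v.fst = toL2 (restrictI φ hφ.continuous) := Lp.ext (hv1.trans (toL2_coe (restrictI φ hφ.continuous)).symm)
    have e2 : v.snd = toL2 (restrictI (deriv φ) hdφ) := Lp.ext (hv2.trans (toL2_coe (restrictI _ hdφ)).symm)
    have hφ0 : φ 0 = 0 := image_eq_zero_of_notMem_tsupport fun h => (hφs h).1.ne rfl
    have hφ1 : φ 1 = 0 := image_eq_zero_of_notMem_tsupport fun h => (hφs h).2.ne rfl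
    have hparts : ∫ x in (0 : ℝ)..1, ((u x - F x) * φ x + u' x * deriv φ x) = 0 := by
      rw [intervalIntegral.integral_eq_sub_of_hasDerivAt (f := fun x => u' x * φ x)
        (fun x _ => (hu' x).mul ((hφ.differentiable (by simp)) x).hasDerivAt)
        (Continuous.intervalIntegrable (by fun_prop) _ _), hφ0, hφ1]
      ring
    rw [hLv, e1, e2, hU, hU', hf, inner_toL2_toL2, inner_toL2_toL2, inner_toL2_toL2]
    simp only [restrictI_apply]
    rw [integral_unitInterval_eq (fun x => u' x * deriv φ x),
      integral_unitInterval_eq (fun x => u x * φ x), integral_unitInterval_eq (fun x => F x * φ x),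
      ← intervalIntegral.integral_sub (Continuous.intervalIntegrable (by fun_prop) _ _)
        (Continuous.intervalIntegrable (by fun_prop) _ _),
      ← intervalIntegral.integral_add (Continuous.intervalIntegrable (by fun_prop) _ _)
        (Continuous.intervalIntegrable (by fun_prop) _ _)]
    refine Eq.trans (intervalIntegral.integral_congr fun x _ => ?_) hparts
    ring
  refine (weak_unique f _ (pair_mem_H10 hu hcu' h0 h1) fun v hv => ?_).symm
  have := hker hv
  change L v = 0 at this
  rw [hLv] at this
  change ⟪U', v.snd⟫_ℝ + ⟪U, v.fst⟫_ℝ = _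
  linarith

/-! ### The Green function of `-d²/dz² + 1` -/

/-- The Green function of `-d²/dz² + 1` on `[0,1]` with Dirichlet conditions. -/
def green (x y : ℝ) : ℝ := Real.sinh (min x y) * Real.sinh (1 - max x y) / Real.sinh 1

theorem continuous_green : Continuous fun p : ℝ × ℝ => green p.1 p.2 := by
  unfold green
  fun_prop

theorem sinh_one_pos : 0 < Real.sinh 1 := Real.sinh_pos_iff.2 one_pos

theorem green_nonneg (x y : I) : 0 ≤ green x y := by
  unfold green
  have h1 : (0 : ℝ) ≤ min (x : ℝ) y := le_min x.2.1 y.2.1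
  have h2 : (0 : ℝ) ≤ 1 - max (x : ℝ) y := sub_nonneg.2 (max_le x.2.2 y.2.2)
  have := Real.sinh_nonneg_iff.2 h1
  have := Real.sinh_nonneg_iff.2 h2
  have := sinh_one_pos
  positivity

theorem green_le_diag (x y : I) : green x y ≤ green x x := by
  unfold green
  have h1 : (0 : ℝ) ≤ min (x : ℝ) x := le_min x.2.1 x.2.1
  have h2 : (0 : ℝ) ≤ 1 - max (x : ℝ) y := sub_nonneg.2 (max_le x.2.2 y.2.2)
  have := Real.sinh_nonneg_iff.2 h1
  have := Real.sinh_nonneg_iff.2 h2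
  have := sinh_one_pos
  gcongr
  · rw [Real.sinh_le_sinh, min_self]; exact min_le_left _ _
  · rw [Real.sinh_le_sinh, max_self]
    linarith [le_max_left (x : ℝ) y]

theorem green_diag_mul_le (x y : I) : green x x * green y y ≤ Real.sinh 1 * green x y := by
  have hs := sinh_one_pos
  have hsinh : ∀ a : ℝ, 0 ≤ a → a ≤ 1 → 0 ≤ Real.sinh a ∧ Real.sinh a ≤ Real.sinh 1 :=
    fun a h h' => ⟨Real.sinh_nonneg_iff.2 h, Real.sinh_le_sinh.2 h'⟩
  have hx := hsinh x x.2.1 x.2.2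
  have hy := hsinh y y.2.1 y.2.2
  have hx' := hsinh (1 - x) (by linarith [x.2.2]) (by linarith [x.2.1])
  have hy' := hsinh (1 - y) (by linarith [y.2.2]) (by linarith [y.2.1])
  have key : ∀ a b c d s : ℝ, 0 ≤ a → 0 ≤ b → 0 ≤ c → 0 ≤ d → c ≤ s → d ≤ s → 0 < s →
      a * c / s * (d * b / s) ≤ s * (a * b / s) := by
    intro a b c d s ha hb hc hd hcs hds hs
    have h1 : c * d ≤ s * s := mul_le_mul hcs hds hd hs.le
    have h2 : a * c / s * (d * b / s) = (a * b) * (c * d) / (s * s) := by field_simp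
    have h3 : s * (a * b / s) = a * b := by field_simp
    rw [h2, h3, div_le_iff₀ (by positivity)]
    exact mul_le_mul_of_nonneg_left h1 (by positivity)
  unfold green
  simp only [min_self, max_self]
  rcases le_total (x : ℝ) y with h | h
  · rw [min_eq_left h, max_eq_right h]
    exact key _ _ _ _ _ hx.1 hy'.1 hx'.1 hy.1 hx'.2 hy.2 hs
  · rw [min_eq_right h, max_eq_left h, mul_comm (_ / _)]
    exact key _ _ _ _ _ hy.1 hx'.1 hy'.1 hx.1 hy'.2 hx.2 hs

theorem green_diag_le (x : I) : green x x ≤ 1 / 4 := by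
  unfold green
  rw [min_self, max_self, div_le_iff₀ sinh_one_pos]
  have h1 : Real.cosh 1 - Real.cosh ((1 - x) - x) = 2 * (Real.sinh x * Real.sinh (1 - x)) := by
    have : Real.cosh 1 = Real.cosh ((1 - x) + x) := by congr 1; ring
    rw [this, Real.cosh_add (1 - x) x, Real.cosh_sub (1 - x) x]
    ring
  have h2 := Real.one_le_cosh ((1 - x) - x)
  -- `2 (cosh 1 - 1) ≤ sinh 1` amounts to `(e - 1) (e - 3) ≤ 0`
  have h3 : 2 * (Real.cosh 1 - 1) ≤ Real.sinh 1 := by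
    rw [Real.cosh_eq, Real.sinh_eq, Real.exp_neg]
    have he := Real.exp_one_lt_d9
    have he' : 1 < Real.exp 1 := by simp
    have hinv : Real.exp 1 * (Real.exp 1)⁻¹ = 1 := mul_inv_cancel₀ (by positivity)
    have hip : 0 < (Real.exp 1)⁻¹ := by positivity
    nlinarith [mul_pos hip (mul_pos (sub_pos.2 he') (sub_pos.2 (he.trans (by norm_num :
      (2.7182818286 : ℝ) < 3))))]
  linarith

theorem green_diag_pos {x : I} (h0 : 0 < (x : ℝ)) (h1 : (x : ℝ) < 1) : 0 < green x x := by
  unfold green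
  rw [min_self, max_self]
  have := sinh_one_pos
  have := Real.sinh_pos_iff.2 h0
  have := Real.sinh_pos_iff.2 (sub_pos.2 h1)
  positivity

/-- The Green function as a continuous function on the square. -/
def greenMap : C(I × I, ℝ) := ⟨fun p => green p.1 p.2, by unfold green; fun_prop⟩

/-- The Green function as an `L²`-valued function of its first variable. -/
def greenKernel : C(I, L2) where
  toFun x := toL2 (greenMap.curry x)
  continuous_toFun :=
    (ContinuousMap.toLp (E := ℝ) 2 volume ℝ).continuous.comp greenMap.curry.continuous

theorem kernelFun_green (f : L2) (x : I) :
    kernelFun greenKernel f x = ∫ y : I, green x y * f y :=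
  inner_toL2_left (greenMap.curry x) f

theorem integrable_green_mul (f : L2) (x : I) : Integrable fun y : I => green x y * f y :=
  integrable_toL2_mul (greenMap.curry x) f

/-- The Green operator solves the boundary value problem for a continuous right-hand side. -/
theorem P0inv_toL2_eq_kernelOp (f : C(I, ℝ)) : P0inv (toL2 f) = kernelOp greenKernel (toL2 f) := by
  set F : ℝ → ℝ := IccExtend (zero_le_one' ℝ) f with hFdef
  have hF : Continuous F := f.continuous.Icc_extend'
  have hFf : ∀ z : I, F z = f z := fun z => IccExtend_val _ _ _
  have hres : restrictI F hF = f := by ext z; exact hFf z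
  let a : ℝ → ℝ := fun x => ∫ t in (0 : ℝ)..x, Real.sinh t * F t
  let c : ℝ → ℝ := fun x => ∫ t in (0 : ℝ)..x, Real.sinh (1 - t) * F t
  have hca : Continuous fun t => Real.sinh t * F t := by fun_prop
  have hcc : Continuous fun t => Real.sinh (1 - t) * F t := by fun_prop
  have ha : ∀ x, HasDerivAt a (Real.sinh x * F x) x := fun x =>
    intervalIntegral.integral_hasDerivAt_right (hca.intervalIntegrable _ _)
      (hca.stronglyMeasurableAtFilter _ _) hca.continuousAt
  have hc : ∀ x, HasDerivAt c (Real.sinh (1 - x) * F x) x := fun x =>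
    intervalIntegral.integral_hasDerivAt_right (hcc.intervalIntegrable _ _)
      (hcc.stronglyMeasurableAtFilter _ _) hcc.continuousAt
  have hs := sinh_one_pos.ne'
  have hsub : ∀ x : ℝ, HasDerivAt (fun x : ℝ => 1 - x) (-1) x := fun x =>
    (hasDerivAt_id x).const_sub 1
  let u : ℝ → ℝ := fun x =>
    (Real.sinh (1 - x) * a x + Real.sinh x * (c 1 - c x)) / Real.sinh 1
  let u' : ℝ → ℝ := fun x =>
    (-Real.cosh (1 - x) * a x + Real.cosh x * (c 1 - c x)) / Real.sinh 1
  have hu : ∀ x, HasDerivAt u (u' x) x := by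
    intro x
    have := ((((hsub x).sinh.mul (ha x)).add
      ((Real.hasDerivAt_sinh x).mul ((hc x).const_sub (c 1)))).div_const (Real.sinh 1))
    refine this.congr_deriv ?_
    simp only [u']
    ring
  have hu' : ∀ x, HasDerivAt u' (u x - F x) x := by
    intro x
    have := ((((hsub x).cosh.neg.mul (ha x)).add
      ((Real.hasDerivAt_cosh x).mul ((hc x).const_sub (c 1)))).div_const (Real.sinh 1))
    refine this.congr_deriv ?_
    have h1 : Real.sinh 1 = Real.sinh (1 - x) * Real.cosh x + Real.cosh (1 - x) * Real.sinh x := by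
      rw [← Real.sinh_add]; congr 1; ring
    have h2 : F x = (Real.sinh (1 - x) * Real.cosh x + Real.cosh (1 - x) * Real.sinh x) * F x
        / Real.sinh 1 := by
      rw [← h1]; field_simp
    simp only [u]
    conv_rhs => rw [h2]
    rw [← sub_div, Pi.neg_apply]
    ring
  have key := P0inv_toL2 hu hu' hF (by simp [u, a]) (by simp [u])
  rw [hres] at key
  rw [key, kernelOp_apply]
  congr 1
  ext x
  have hcg : Continuous fun t => green x t * F t :=
    (continuous_green.comp (by fun_prop : Continuous fun t : ℝ => ((x : ℝ), t))).mul hF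
  have h1 : kernelFun greenKernel (toL2 f) x = ∫ t in (0 : ℝ)..1, green x t * F t := by
    rw [kernelFun_green, ← integral_unitInterval_eq (fun t => green x t * F t)]
    refine integral_congr_ae ?_
    filter_upwards [toL2_coe f] with z hz
    rw [hz, hFf]
  have h2 : ∫ t in (0 : ℝ)..x, green x t * F t = Real.sinh (1 - x) / Real.sinh 1 * a x := by
    rw [← intervalIntegral.integral_const_mul]
    refine intervalIntegral.integral_congr fun t ht => ?_
    rw [uIcc_of_le x.2.1] at ht
    simp only [green, min_eq_right ht.2, max_eq_left ht.2]
    ring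
  have h3 : ∫ t in (x : ℝ)..1, green x t * F t = Real.sinh x / Real.sinh 1 * (c 1 - c x) := by
    have : c 1 - c x = ∫ t in (x : ℝ)..1, Real.sinh (1 - t) * F t :=
      intervalIntegral.integral_interval_sub_left (hcc.intervalIntegrable _ _)
        (hcc.intervalIntegrable _ _)
    rw [this, ← intervalIntegral.integral_const_mul]
    refine intervalIntegral.integral_congr fun t ht => ?_
    rw [uIcc_of_le x.2.2] at ht
    simp only [green, min_eq_left ht.1, max_eq_right ht.1]
    ring
  rw [h1, ← intervalIntegral.integral_add_adjacent_intervals (hcg.intervalIntegrable 0 x)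
    (hcg.intervalIntegrable x 1), h2, h3, restrictI_apply]
  simp only [u]
  ring

theorem P0inv_eq_kernelOp : P0inv = kernelOp greenKernel := by
  have hd : DenseRange (ContinuousMap.toLp 2 (volume : Measure I) ℝ : C(I, ℝ) →L[ℝ] L2) :=
    ContinuousMap.toLp_denseRange ℝ _ ℝ (by simp)
  refine ContinuousLinearMap.ext fun f => congrFun (hd.equalizer P0inv.continuous
    (kernelOp greenKernel).continuous (funext fun g => ?_)) f
  exact P0inv_toL2_eq_kernelOp g

theorem isCompactOperator_P0inv : IsCompactOperator P0inv :=
  P0inv_eq_kernelOp ▸ isCompactOperator_kernelOp greenKernel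

theorem P0inv_coe (f : L2) : P0inv f =ᵐ[volume] fun x : I => ∫ y : I, green x y * f y := by
  rw [P0inv_eq_kernelOp, kernelOp_apply]
  filter_upwards [toL2_coe (kernelFun greenKernel f)] with x hx
  rw [hx, kernelFun_green]

theorem isSelfAdjoint_P0inv : IsSelfAdjoint P0inv :=
  (ContinuousLinearMap.isPositive_self_comp_adjoint incl).isSelfAdjoint

theorem inner_P0inv_nonneg (f : L2) : 0 ≤ ⟪f, P0inv f⟫_ℝ :=
  (ContinuousLinearMap.isPositive_self_comp_adjoint incl).inner_nonneg_right f

theorem integrable_L2 (f : L2) : Integrable fun y : I => f y := (Lp.memLp f).integrable (by norm_num)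

/-- The diagonal `x ↦ G(x,x)` of the Green function. -/
def greenDiag : C(I, ℝ) := ⟨fun x => green x x, by unfold green; fun_prop⟩

theorem integral_green_le {f : L2} (hf : 0 ≤ᵐ[volume] (f : I → ℝ)) (x : I) :
    ∫ y : I, green x y * f y ≤ green x x * ∫ y : I, f y := by
  rw [← integral_const_mul]
  refine integral_mono_ae (integrable_green_mul f x) ((integrable_L2 f).const_mul _) ?_
  filter_upwards [hf] with y hy
  exact mul_le_mul_of_nonneg_right (green_le_diag x y) hy

theorem le_integral_green {f : L2} (hf : 0 ≤ᵐ[volume] (f : I → ℝ)) (x : I) :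
    green x x * ∫ y : I, green y y * f y ≤ Real.sinh 1 * ∫ y : I, green x y * f y := by
  rw [← integral_const_mul, ← integral_const_mul]
  refine integral_mono_ae ((integrable_toL2_mul greenDiag f).const_mul _)
    ((integrable_green_mul f x).const_mul _) ?_
  filter_upwards [hf] with y hy
  change green x x * (green y y * f y) ≤ _
  rw [← mul_assoc, ← mul_assoc]
  exact mul_le_mul_of_nonneg_right (green_diag_mul_le x y) hy

theorem integral_green_nonneg {f : L2} (hf : 0 ≤ᵐ[volume] (f : I → ℝ)) (x : I) :
    0 ≤ ∫ y : I, green x y * f y := by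
  refine integral_nonneg_of_ae ?_
  filter_upwards [hf] with y hy
  exact mul_nonneg (green_nonneg x y) hy

/-- The class of `z ↦ sin (π z)`, the first Dirichlet eigenfunction. -/
def sinPi : L2 := toL2 (restrictI (fun x => Real.sin (Real.pi * x)) (by fun_prop))

theorem P0inv_sinPi : P0inv sinPi = (1 + Real.pi ^ 2)⁻¹ • sinPi := by
  have hpi : (1 + Real.pi ^ 2) ≠ 0 := by positivity
  have hm : ∀ x : ℝ, HasDerivAt (fun x : ℝ => Real.pi * x) Real.pi x := fun x => by
    simpa using (hasDerivAt_id x).const_mul Real.pi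
  have h := P0inv_toL2 (u := fun x => (1 + Real.pi ^ 2)⁻¹ * Real.sin (Real.pi * x))
    (u' := fun x => (1 + Real.pi ^ 2)⁻¹ * (Real.cos (Real.pi * x) * Real.pi))
    (F := fun x => Real.sin (Real.pi * x))
    (fun x => (hm x).sin.const_mul _)
    (fun x => by
      refine (((hm x).cos.mul_const Real.pi).const_mul (1 + Real.pi ^ 2)⁻¹).congr_deriv ?_
      field_simp
      ring)
    (by fun_prop) (by simp) (by simp)
  rw [sinPi, h]
  unfold toL2
  rw [← map_smul]
  rfl

theorem sinPi_ne_zero : sinPi ≠ 0 := by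
  intro h
  have h1 : ⟪toL2 1, sinPi⟫_ℝ = 2 / Real.pi := by
    rw [sinPi, inner_toL2_toL2]
    simp only [ContinuousMap.one_apply, one_mul, restrictI_apply]
    rw [integral_unitInterval_eq (fun x => Real.sin (Real.pi * x)),
      intervalIntegral.integral_comp_mul_left (fun x => Real.sin x) Real.pi_ne_zero]
    simp
    ring
  rw [h, inner_zero_right] at h1
  have := div_pos two_pos Real.pi_pos
  linarith

theorem norm_P0inv_ge : 1 / 11 ≤ ‖P0inv‖ := by
  have h := P0inv.le_opNorm sinPi
  rw [P0inv_sinPi, norm_smul] at h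
  have h1 := le_of_mul_le_mul_right h (norm_pos_iff.2 sinPi_ne_zero)
  rw [Real.norm_of_nonneg (by positivity)] at h1
  refine le_trans ?_ h1
  rw [one_div]
  have hpi : Real.pi ^ 2 ≤ 10 := by
    have := Real.pi_lt_d2
    nlinarith [Real.pi_pos]
  gcongr
  linarith

/-- `L²([0,1])` has dimension at least two. -/
theorem exists_orthogonal_ne_zero (ψ : L2) : ∃ y : L2, y ≠ 0 ∧ ⟪ψ, y⟫_ℝ = 0 := by
  set e := toL2 1 with he
  set f := toL2 (restrictI (fun x => x) continuous_id) with hf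
  have hee : ⟪e, e⟫_ℝ = 1 := by rw [he, inner_toL2_toL2]; simp
  have hef : ⟪e, f⟫_ℝ = 1 / 2 := by
    rw [he, hf, inner_toL2_toL2]
    simp only [ContinuousMap.one_apply, one_mul, restrictI_apply]
    rw [integral_unitInterval_eq (fun x => x)]
    simp
  have hff : ⟪f, f⟫_ℝ = 1 / 3 := by
    rw [hf, inner_toL2_toL2]
    simp only [restrictI_apply]
    rw [integral_unitInterval_eq (fun x => x * x)]
    simp only [← sq]
    norm_num
  by_cases hψ : ⟪ψ, e⟫_ℝ = 0
  · exact ⟨e, fun h => by simp [h] at hee, hψ⟩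
  · refine ⟨⟪ψ, f⟫_ℝ • e - ⟪ψ, e⟫_ℝ • f, fun h => hψ ?_, ?_⟩
    · have h1 : ⟪⟪ψ, f⟫_ℝ • e - ⟪ψ, e⟫_ℝ • f, e⟫_ℝ = 0 := by rw [h, inner_zero_left]
      have h2 : ⟪⟪ψ, f⟫_ℝ • e - ⟪ψ, e⟫_ℝ • f, f⟫_ℝ = 0 := by rw [h, inner_zero_left]
      rw [inner_sub_left, real_inner_smul_left, real_inner_smul_left, hee,
        real_inner_comm e f, hef]
        at h1
      rw [inner_sub_left, real_inner_smul_left, real_inner_smul_left, hef, hff] at h2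
      linarith
    · rw [inner_sub_right, real_inner_smul_right, real_inner_smul_right]
      ring

/-! ### Order and multiplication in `L²([0,1])` -/

theorem inner_mulOp_left (g : C(I, ℝ)) (f k : L2) : ⟪mulOp g f, k⟫_ℝ = ⟪f, mulOp g k⟫_ℝ := by
  rw [inner_L2_eq, inner_L2_eq]
  refine integral_congr_ae ?_
  filter_upwards [mulOp_coe g f, mulOp_coe g k] with z h1 h2
  rw [h1, h2]
  ring

theorem mulOp_sub (g k : C(I, ℝ)) : mulOp (g - k) = mulOp g - mulOp k := by
  unfold mulOp
  rw [map_sub, map_sub]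

theorem mulOp_mulOp (g k : C(I, ℝ)) (f : L2) : mulOp g (mulOp k f) = mulOp (g * k) f := by
  refine Lp.ext ?_
  filter_upwards [mulOp_coe g (mulOp k f), mulOp_coe k f, mulOp_coe (g * k) f] with z h1 h2 h3
  rw [h1, h2, h3, ContinuousMap.mul_apply, mul_assoc]

theorem norm_mulOp_le {g : C(I, ℝ)} {C : ℝ} (hC : ∀ z, |g z| ≤ C) : ‖mulOp g‖ ≤ C := by
  refine ContinuousLinearMap.opNorm_le_bound _ ((abs_nonneg _).trans (hC 0)) fun f => ?_
  refine Lp.norm_le_mul_norm_of_ae_le_mul ?_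
  filter_upwards [mulOp_coe g f] with z hz
  rw [hz, norm_mul]
  exact mul_le_mul_of_nonneg_right (hC z) (norm_nonneg _)

theorem norm_L2_le_of_ae_bound {f : L2} {C : ℝ} (hC : 0 ≤ C) (h : ∀ᵐ z, |f z| ≤ C) : ‖f‖ ≤ C := by
  refine (Lp.norm_le_of_ae_bound hC h).trans ?_
  simp [measureUnivNNReal]

theorem mulOp_nonneg {g : C(I, ℝ)} (hg : ∀ z, 0 ≤ g z) {f : L2} (hf : 0 ≤ f) : 0 ≤ mulOp g f := by
  rw [← Lp.coeFn_nonneg] at hf ⊢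
  filter_upwards [hf, mulOp_coe g f] with z h1 h2
  rw [h2]
  exact mul_nonneg (hg z) h1

theorem inner_nonneg_L2 {f g : L2} (hf : 0 ≤ f) (hg : 0 ≤ g) : 0 ≤ ⟪f, g⟫_ℝ := by
  rw [← Lp.coeFn_nonneg] at hf hg
  rw [inner_L2_eq]
  refine integral_nonneg_of_ae ?_
  filter_upwards [hf, hg] with z h1 h2
  exact mul_nonneg h1 h2

theorem inner_le_inner_L2 {f g k : L2} (hf : 0 ≤ f) (hg : g ≤ k) : ⟪f, g⟫_ℝ ≤ ⟪f, k⟫_ℝ := by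
  have := inner_nonneg_L2 hf (sub_nonneg.2 hg)
  rw [inner_sub_right] at this
  linarith

theorem inner_pos_L2 {f g : L2} (hf : ∀ᵐ z, 0 < f z) (hg : 0 ≤ g) (hg0 : g ≠ 0) :
    0 < ⟪f, g⟫_ℝ := by
  have hg' := (Lp.coeFn_nonneg g).2 hg
  have hnn : 0 ≤ᵐ[volume] fun z : I => f z * g z := by
    filter_upwards [hf, hg'] with z h1 h2
    exact mul_nonneg h1.le h2
  rw [inner_L2_eq]
  refine lt_of_le_of_ne (integral_nonneg_of_ae hnn) fun h => hg0 ?_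
  have h0 := (integral_eq_zero_iff_of_nonneg_ae hnn (integrable_mul_L2 f g)).1 h.symm
  rw [Lp.eq_zero_iff_ae_eq_zero]
  filter_upwards [h0, hf] with z h1 h2
  exact (mul_eq_zero.1 h1).resolve_left h2.ne'

theorem abs_ne_zero_L2 {f : L2} (hf : f ≠ 0) : |f| ≠ 0 := by
  rwa [← norm_ne_zero_iff, norm_abs_eq_norm, norm_ne_zero_iff]

theorem abs_add_nonneg_L2 (f : L2) : 0 ≤ |f| + f := by
  have := sub_nonneg.2 (neg_le_abs f)
  rwa [sub_neg_eq_add] at this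

theorem smul_le_smul_L2 {c : ℝ} (hc : 0 ≤ c) {f g : L2} (h : f ≤ g) : c • f ≤ c • g := by
  rw [← Lp.coeFn_le] at h ⊢
  filter_upwards [h, Lp.coeFn_smul c f, Lp.coeFn_smul c g] with z h1 h2 h3
  rw [h2, h3]
  exact mul_le_mul_of_nonneg_left h1 hc

theorem smul_nonneg_L2 {c : ℝ} (hc : 0 ≤ c) {f : L2} (hf : 0 ≤ f) : 0 ≤ c • f := by
  simpa using smul_le_smul_L2 hc hf

theorem smul_le_smul_right_L2 {c d : ℝ} (h : c ≤ d) {f : L2} (hf : 0 ≤ f) : c • f ≤ d • f := by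
  have := smul_nonneg_L2 (sub_nonneg.2 h) hf
  rwa [sub_smul, sub_nonneg] at this

theorem smul_abs_le_L2 (c : ℝ) (f : L2) : c • |f| ≤ |c • f| := by
  rw [← Lp.coeFn_le]
  filter_upwards [Lp.coeFn_smul c f, Lp.coeFn_smul c |f|, Lp.coeFn_abs f, Lp.coeFn_abs (c • f)]
    with z h1 h2 h3 h4
  rw [h2, h4, h1, Pi.smul_apply, Pi.smul_apply, h3, smul_eq_mul, smul_eq_mul, abs_mul]
  exact mul_le_mul_of_nonneg_right (le_abs_self c) (abs_nonneg _)

theorem abs_apply_le {S : L2 →L[ℝ] L2} (hS : ∀ f, 0 ≤ f → 0 ≤ S f) (f : L2) : |S f| ≤ S |f| := by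
  refine abs_le'.2 ⟨?_, ?_⟩
  · have := hS (|f| - f) (sub_nonneg.2 (le_abs_self f))
    rwa [map_sub, sub_nonneg] at this
  · have := hS (|f| + f) (abs_add_nonneg_L2 f)
    rwa [map_add, ← sub_neg_eq_add, sub_nonneg] at this

/-! ### The ground state of the weighted resolvent -/

/-- The operator `p (-d²/dz² + 1)⁻¹ p` on `L²([0,1])` for a continuous weight `p`. -/
def weightedOp (p : C(I, ℝ)) : L2 →L[ℝ] L2 := mulOp p ∘L P0inv ∘L mulOp p

theorem weightedOp_apply (p : C(I, ℝ)) (f : L2) :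
    weightedOp p f = mulOp p (P0inv (mulOp p f)) := rfl

theorem isCompactOperator_weightedOp (p : C(I, ℝ)) : IsCompactOperator (weightedOp p) :=
  (isCompactOperator_P0inv.comp_clm (mulOp p)).clm_comp (mulOp p)

theorem weightedOp_isSymmetric (p : C(I, ℝ)) : (weightedOp p).IsSymmetric := by
  intro f g
  change ⟪mulOp p (P0inv (mulOp p f)), g⟫_ℝ = ⟪f, mulOp p (P0inv (mulOp p g))⟫_ℝ
  rw [inner_mulOp_left, ← inner_mulOp_left p f]
  exact isSelfAdjoint_P0inv.isSymmetric _ _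

theorem inner_weightedOp_nonneg (p : C(I, ℝ)) (f : L2) : 0 ≤ ⟪f, weightedOp p f⟫_ℝ := by
  rw [weightedOp_apply, ← inner_mulOp_left]
  exact inner_P0inv_nonneg _

theorem inner_weightedOp_le (p : C(I, ℝ)) (f : L2) :
    ⟪f, weightedOp p f⟫_ℝ ≤ ‖weightedOp p‖ * ‖f‖ ^ 2 := by
  have h1 := real_inner_le_norm f (weightedOp p f)
  have h2 := (weightedOp p).le_opNorm f
  nlinarith [norm_nonneg f]

theorem P0inv_nonneg {f : L2} (hf : 0 ≤ f) : 0 ≤ P0inv f := by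
  have hf' := (Lp.coeFn_nonneg f).2 hf
  rw [← Lp.coeFn_nonneg]
  filter_upwards [P0inv_coe f] with z hz
  rw [hz]
  exact integral_green_nonneg hf' z

theorem weightedOp_nonneg {p : C(I, ℝ)} (hp : ∀ z, 0 ≤ p z) {f : L2} (hf : 0 ≤ f) :
    0 ≤ weightedOp p f :=
  mulOp_nonneg hp (P0inv_nonneg (mulOp_nonneg hp hf))

theorem integral_mulOp (p : C(I, ℝ)) (f : L2) : ∫ z : I, mulOp p f z = ⟪toL2 p, f⟫_ℝ := by
  rw [inner_toL2_left]
  exact integral_congr_ae (mulOp_coe p f)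

/-- The upper Green bound: a nonnegative source of total mass one has a solution below the diagonal
of the Green function. -/
theorem weightedOp_le {p : C(I, ℝ)} (hp : ∀ z, 0 ≤ p z) {f : L2} (hf : 0 ≤ f)
    (h1 : ⟪toL2 p, f⟫_ℝ = 1) : weightedOp p f ≤ toL2 (p * greenDiag) := by
  have hf' := (Lp.coeFn_nonneg _).2 (mulOp_nonneg hp hf)
  rw [← Lp.coeFn_le]
  filter_upwards [mulOp_coe p (P0inv (mulOp p f)), P0inv_coe (mulOp p f),
    toL2_coe (p * greenDiag)] with z h2 h3 h4
  rw [weightedOp_apply, h2, h3, h4]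
  refine mul_le_mul_of_nonneg_left ((integral_green_le hf' z).trans ?_) (hp z)
  rw [integral_mulOp, h1, mul_one]
  rfl

/-- The lower Green bound: the weighted resolvent dominates a rank-one operator. -/
theorem rankOne_le_weightedOp {p : C(I, ℝ)} (hp : ∀ z, 0 ≤ p z) {f : L2} (hf : 0 ≤ f) :
    ⟪toL2 (p * greenDiag), f⟫_ℝ • toL2 (p * greenDiag) ≤ Real.sinh 1 • weightedOp p f := by
  have hf' := (Lp.coeFn_nonneg _).2 (mulOp_nonneg hp hf)
  rw [← Lp.coeFn_le]
  have hint : ⟪toL2 (p * greenDiag), f⟫_ℝ = ∫ y : I, green y y * mulOp p f y := by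
    rw [inner_toL2_left]
    refine integral_congr_ae ?_
    filter_upwards [mulOp_coe p f] with z hz
    rw [hz, ContinuousMap.mul_apply]
    change p z * green z z * f z = _
    ring
  filter_upwards [mulOp_coe p (P0inv (mulOp p f)), P0inv_coe (mulOp p f),
    toL2_coe (p * greenDiag), Lp.coeFn_smul ⟪toL2 (p * greenDiag), f⟫_ℝ (toL2 (p * greenDiag)),
    Lp.coeFn_smul (Real.sinh 1) (weightedOp p f)] with z h2 h3 h4 h5 h6
  rw [h5, h6, Pi.smul_apply, Pi.smul_apply, h4, weightedOp_apply, h2, h3, smul_eq_mul, smul_eq_mul,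
    hint, ContinuousMap.mul_apply]
  change _ * (p z * green z z) ≤ _
  nlinarith [mul_le_mul_of_nonneg_left (le_integral_green hf' z) (hp z)]

theorem ae_pos_toL2_mul_greenDiag {p : C(I, ℝ)} (hp : ∀ z, 0 < p z) :
    ∀ᵐ z, 0 < toL2 (p * greenDiag) z := by
  have h0 : ∀ᵐ z : I, z ≠ 0 := Measure.ae_ne _ _
  have h1 : ∀ᵐ z : I, z ≠ 1 := Measure.ae_ne _ _
  filter_upwards [toL2_coe (p * greenDiag), h0, h1] with z hz hz0 hz1
  rw [hz, ContinuousMap.mul_apply]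
  exact mul_pos (hp z) (green_diag_pos (unitInterval.pos_iff_ne_zero.2 hz0)
    (unitInterval.lt_one_iff_ne_one.2 hz1))

/-- The Rayleigh quotient at `sin (π z) / p`. -/
theorem norm_weightedOp_ge {p : C(I, ℝ)} {m : ℝ} (hm : 0 < m) (hp : ∀ z, m ≤ p z) :
    m ^ 2 / 11 ≤ ‖weightedOp p‖ := by
  let r : C(I, ℝ) := ⟨fun z => (p z)⁻¹, p.continuous.inv₀ fun z => (hm.trans_le (hp z)).ne'⟩
  have hr : p * r = 1 := by
    ext z
    exact mul_inv_cancel₀ (hm.trans_le (hp z)).ne'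
  set x := mulOp r sinPi with hx
  have hpx : mulOp p x = sinPi := by
    rw [hx, mulOp_mulOp, hr]
    refine Lp.ext ?_
    filter_upwards [mulOp_coe 1 sinPi] with z hz
    rw [hz, ContinuousMap.one_apply, one_mul]
  have h1 := inner_weightedOp_le p x
  rw [weightedOp_apply, ← inner_mulOp_left, hpx, P0inv_sinPi, real_inner_smul_right,
    real_inner_self_eq_norm_sq] at h1
  have h2 : ‖x‖ ≤ m⁻¹ * ‖sinPi‖ := by
    refine (mulOp r).le_of_opNorm_le (norm_mulOp_le fun z => ?_) _
    change |(p z)⁻¹| ≤ m⁻¹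
    rw [abs_inv, abs_of_pos (hm.trans_le (hp z))]
    exact inv_anti₀ hm (hp z)
  have h3 : ‖x‖ ^ 2 ≤ (m⁻¹ * ‖sinPi‖) ^ 2 := by gcongr
  have hs : 0 < ‖sinPi‖ ^ 2 := by
    have := norm_pos_iff.2 sinPi_ne_zero
    positivity
  have h4 : (1 + Real.pi ^ 2)⁻¹ * ‖sinPi‖ ^ 2 ≤ (‖weightedOp p‖ / m ^ 2) * ‖sinPi‖ ^ 2 := by
    calc _ ≤ ‖weightedOp p‖ * ‖x‖ ^ 2 := h1
      _ ≤ ‖weightedOp p‖ * (m⁻¹ * ‖sinPi‖) ^ 2 := by gcongr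
      _ = _ := by field_simp
  have h5 := le_of_mul_le_mul_right h4 hs
  rw [le_div_iff₀ (by positivity)] at h5
  refine le_trans ?_ h5
  have hpi : Real.pi ^ 2 ≤ 10 := by
    have := Real.pi_lt_d2
    nlinarith [Real.pi_pos]
  have h6 : (11 : ℝ)⁻¹ ≤ (1 + Real.pi ^ 2)⁻¹ := by
    gcongr
    linarith
  nlinarith [sq_nonneg m]

/-- The top eigenvalue has a nonnegative eigenvector: the modulus of any top eigenvector maximizes
the quadratic form as well. -/
theorem exists_nonneg_eigenvector {p : C(I, ℝ)} (hp : ∀ z, 0 < p z) :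
    ∃ ψ : L2, weightedOp p ψ = ‖weightedOp p‖ • ψ ∧ 0 ≤ ψ ∧ ⟪toL2 p, ψ⟫_ℝ = 1 := by
  obtain ⟨y, hy, -⟩ := exists_orthogonal_ne_zero 0
  have : Nontrivial L2 := ⟨y, 0, hy⟩
  obtain ⟨χ, hχ0, hχ⟩ := exists_eigenvector_norm (isCompactOperator_weightedOp p)
    (weightedOp_isSymmetric p) (inner_weightedOp_nonneg p)
  have habs : weightedOp p |χ| = ‖weightedOp p‖ • |χ| := by
    refine eq_norm_smul_of_le_inner ?_
    have h1 : ‖weightedOp p‖ • |χ| ≤ weightedOp p |χ| := by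
      have h := abs_apply_le (fun f hf => weightedOp_nonneg (fun z => (hp z).le) hf) χ
      rw [hχ] at h
      exact (smul_abs_le_L2 _ _).trans h
    have h2 := inner_le_inner_L2 (abs_nonneg χ) h1
    rwa [real_inner_smul_right, real_inner_self_eq_norm_sq] at h2
  have hp' : ∀ᵐ z, 0 < toL2 p z := by
    filter_upwards [toL2_coe p] with z hz
    rw [hz]
    exact hp z
  have hc : 0 < ⟪toL2 p, |χ|⟫_ℝ := inner_pos_L2 hp' (abs_nonneg χ) (abs_ne_zero_L2 hχ0)
  refine ⟨(⟪toL2 p, |χ|⟫_ℝ)⁻¹ • |χ|, ?_, ?_, ?_⟩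
  · rw [map_smul, habs, smul_comm]
  · exact smul_nonneg_L2 (inv_nonneg.2 hc.le) (abs_nonneg χ)
  · rw [real_inner_smul_right, inv_mul_cancel₀ hc.ne']

/-- Quantitative Perron–Frobenius gap. The Green bounds give `κ ⟪ψ, f⟫ ψ ≤ weightedOp p f` for
`f ≥ 0`, with `κ = ‖weightedOp p‖² / sinh 1`, so that subtracting `κ ψ ⊗ ψ` preserves positivity.
The difference still has the eigenvector `χ ⟂ ψ`, while it lowers the eigenvalue of `ψ > 0`; pairing
`|χ|` with `ψ` compares the two eigenvalues. -/
theorem eigenvalue_le_of_orthogonal {p : C(I, ℝ)} (hp : ∀ z, 0 < p z) {ψ χ : L2} {l : ℝ}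
    (hψ : weightedOp p ψ = ‖weightedOp p‖ • ψ) (hψ0 : 0 ≤ ψ) (hψ1 : ⟪toL2 p, ψ⟫_ℝ = 1)
    (hχ : weightedOp p χ = l • χ) (hχ0 : χ ≠ 0) (hort : ⟪ψ, χ⟫_ℝ = 0) :
    l ≤ ‖weightedOp p‖ - ‖weightedOp p‖ ^ 2 / Real.sinh 1 * ‖ψ‖ ^ 2 := by
  set μ := ‖weightedOp p‖ with hμ
  set b := toL2 (p * greenDiag) with hb
  have hs := sinh_one_pos
  have hp0 : ∀ z, 0 ≤ p z := fun z => (hp z).le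
  have hψne : ψ ≠ 0 := fun h => by simp [h] at hψ1
  have hbpos : ∀ᵐ z, 0 < b z := ae_pos_toL2_mul_greenDiag hp
  have hup : μ • ψ ≤ b := hψ ▸ weightedOp_le hp0 hψ0 hψ1
  have hbψ : 0 < ⟪b, ψ⟫_ℝ := inner_pos_L2 hbpos hψ0 hψne
  have hψpos : ∀ᵐ z, 0 < ψ z := by
    have h := rankOne_le_weightedOp hp0 hψ0
    rw [hψ, smul_smul, ← hb, ← Lp.coeFn_le] at h
    filter_upwards [h, hbpos, Lp.coeFn_smul ⟪b, ψ⟫_ℝ b, Lp.coeFn_smul (Real.sinh 1 * μ) ψ]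
      with z h1 h2 h3 h4
    rw [h3, h4, Pi.smul_apply, Pi.smul_apply, smul_eq_mul, smul_eq_mul] at h1
    have h5 : 0 < Real.sinh 1 * μ * ψ z := (mul_pos hbψ h2).trans_le h1
    exact pos_of_mul_pos_right h5 (by positivity)
  have hμψ : 0 ≤ μ • ψ := smul_nonneg_L2 (norm_nonneg _) hψ0
  have hdom : ∀ f : L2, 0 ≤ f → (μ ^ 2 / Real.sinh 1 * ⟪ψ, f⟫_ℝ) • ψ ≤ weightedOp p f := by
    intro f hf
    have h1 : ⟪μ • ψ, f⟫_ℝ • (μ • ψ) ≤ ⟪b, f⟫_ℝ • b := by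
      have h11 : ⟪μ • ψ, f⟫_ℝ ≤ ⟪b, f⟫_ℝ := by
        rw [real_inner_comm, real_inner_comm f b]
        exact inner_le_inner_L2 hf hup
      exact (smul_le_smul_right_L2 h11 hμψ).trans
        (smul_le_smul_L2 ((inner_nonneg_L2 hμψ hf).trans h11) hup)
    have h2 := smul_le_smul_L2 (inv_nonneg.2 hs.le)
      (h1.trans (rankOne_le_weightedOp hp0 hf))
    rw [smul_smul, smul_smul, smul_smul, inv_mul_cancel₀ hs.ne', one_smul,
      real_inner_smul_left] at h2
    convert h2 using 2
    ring
  set t := ⟪ψ, |χ|⟫_ℝ with ht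
  have htpos : 0 < t := inner_pos_L2 hψpos (abs_nonneg χ) (abs_ne_zero_L2 hχ0)
  have h1 : l • χ ≤ weightedOp p |χ| - (μ ^ 2 / Real.sinh 1 * t) • ψ := by
    have h := hdom (|χ| - χ) (sub_nonneg.2 (le_abs_self χ))
    rw [inner_sub_right, hort, sub_zero, map_sub, hχ] at h
    exact le_sub_comm.1 h
  have h2 : -(l • χ) ≤ weightedOp p |χ| - (μ ^ 2 / Real.sinh 1 * t) • ψ := by
    have h := hdom (|χ| + χ) (abs_add_nonneg_L2 χ)
    rw [inner_add_right, hort, add_zero, map_add, hχ] at h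
    rw [le_sub_iff_add_le, neg_add_le_iff_le_add, add_comm]
    exact h
  have h3 : l • |χ| ≤ weightedOp p |χ| - (μ ^ 2 / Real.sinh 1 * t) • ψ := by
    refine le_trans ?_ (abs_le'.2 ⟨h1, h2⟩)
    exact smul_abs_le_L2 l χ
  have h4 := inner_le_inner_L2 hψ0 h3
  have h5 : ⟪ψ, weightedOp p |χ|⟫_ℝ = μ * t := by
    have h := weightedOp_isSymmetric p ψ |χ|
    simp only [ContinuousLinearMap.coe_coe] at h
    rw [← h, hψ, real_inner_smul_left]
  rw [real_inner_smul_right, inner_sub_right, real_inner_smul_right, h5,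
    real_inner_self_eq_norm_sq, ← ht] at h4
  refine le_of_mul_le_mul_right ?_ htpos
  linarith

/-! ### The two largest eigenvalues -/

theorem hasEigenvalue_of_apply_eq {T : L2 →L[ℝ] L2} {μ : ℝ} {ψ : L2} (hψ : T ψ = μ • ψ)
    (hψ0 : ψ ≠ 0) : Module.End.HasEigenvalue (T : Module.End ℝ L2) μ :=
  Module.End.hasEigenvalue_of_hasEigenvector ⟨Module.End.mem_eigenspace_iff.2 hψ, hψ0⟩

theorem isGreatest_eigenvalue {T : L2 →L[ℝ] L2} {μ : ℝ} {ψ : L2} (hψ : T ψ = μ • ψ) (hψ0 : ψ ≠ 0)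
    (hmax : ∀ x, ⟪x, T x⟫_ℝ ≤ μ * ‖x‖ ^ 2) :
    IsGreatest {ν | Module.End.HasEigenvalue (T : Module.End ℝ L2) ν} μ := by
  refine ⟨hasEigenvalue_of_apply_eq hψ hψ0, fun ν hν => ?_⟩
  obtain ⟨x, hx⟩ := Module.End.HasEigenvalue.exists_hasEigenvector hν
  have h1 : T x = ν • x := hx.apply_eq_smul
  have h2 := hmax x
  rw [h1, real_inner_smul_right, real_inner_self_eq_norm_sq] at h2
  have := norm_pos_iff.2 hx.2
  exact le_of_mul_le_mul_right h2 (by positivity)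

theorem nthEigenvalue_one {T : L2 →L[ℝ] L2} {μ : ℝ}
    (h : IsGreatest {ν | Module.End.HasEigenvalue (T : Module.End ℝ L2) ν} μ) :
    nthEigenvalue T 1 = μ := by
  have hset : {ν | Module.End.HasEigenvalue (T : Module.End ℝ L2) ν ∧ ((1 : ℕ) : Cardinal) ≤
      Module.rank ℝ (⨆ ν' ∈ Ici ν, Module.End.eigenspace (T : Module.End ℝ L2) ν' :
        Submodule ℝ L2)} = {ν | Module.End.HasEigenvalue (T : Module.End ℝ L2) ν} := by
    ext ν
    simp only [mem_ofPred_eq, and_iff_left_iff_imp]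
    intro hν
    rw [Nat.cast_one, Cardinal.one_le_iff_ne_zero]
    intro h0
    rw [Submodule.rank_eq_zero] at h0
    refine hν (eq_bot_iff.2 ?_)
    rw [← h0]
    exact le_biSup (fun ν' => Module.End.eigenspace (T : Module.End ℝ L2) ν') self_mem_Ici
  rw [nthEigenvalue, hset]
  exact h.csSup_eq

/-- An eigenvector whose eigenvalue exceeds the quadratic form on `ψᗮ` is a multiple of `ψ`. -/
theorem exists_eq_smul_of_lt {T : L2 →L[ℝ] L2} {μ l ν : ℝ} {ψ x : L2} (hψ : T ψ = μ • ψ)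
    (hψ0 : ψ ≠ 0) (hl : ∀ x, ⟪ψ, x⟫_ℝ = 0 → ⟪x, T x⟫_ℝ ≤ l * ‖x‖ ^ 2) (hν : l < ν)
    (hx : T x = ν • x) : ∃ a : ℝ, x = a • ψ := by
  have hn : ‖ψ‖ ^ 2 ≠ 0 := by simpa using hψ0
  set a := ⟪ψ, x⟫_ℝ / ‖ψ‖ ^ 2 with ha
  set y := x - a • ψ with hy
  have hψy : ⟪ψ, y⟫_ℝ = 0 := by
    rw [hy, inner_sub_right, real_inner_smul_right, real_inner_self_eq_norm_sq, ha]
    field_simp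
    ring
  have h1 : T y = ν • y + (a * (ν - μ)) • ψ := by
    rw [hy, map_sub, map_smul, hψ, hx]
    module
  have h2 := hl y hψy
  rw [h1, inner_add_right, real_inner_smul_right, real_inner_smul_right, real_inner_comm ψ y, hψy,
    real_inner_self_eq_norm_sq] at h2
  have h3 : ‖y‖ ^ 2 = 0 := by nlinarith [sq_nonneg ‖y‖]
  have h4 : y = 0 := by simpa using h3
  exact ⟨a, sub_eq_zero.1 h4⟩

theorem nthEigenvalue_two {T : L2 →L[ℝ] L2} {μ l : ℝ} {ψ χ : L2} (hψ : T ψ = μ • ψ)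
    (hψ0 : ψ ≠ 0) (hχ : T χ = l • χ) (hχ0 : χ ≠ 0) (hort : ⟪ψ, χ⟫_ℝ = 0)
    (hl : ∀ x, ⟪ψ, x⟫_ℝ = 0 → ⟪x, T x⟫_ℝ ≤ l * ‖x‖ ^ 2) (hlt : l < μ) :
    nthEigenvalue T 2 = l := by
  refine IsGreatest.csSup_eq ⟨⟨hasEigenvalue_of_apply_eq hχ hχ0, ?_⟩, fun ν hν => ?_⟩
  · set U : Submodule ℝ L2 :=
      ⨆ ν' ∈ Ici l, Module.End.eigenspace (T : Module.End ℝ L2) ν' with hU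
    have hmem : ∀ (ν : ℝ) (x : L2), l ≤ ν → T x = ν • x → x ∈ U := fun ν x hν hx =>
      (le_biSup (fun ν' => Module.End.eigenspace (T : Module.End ℝ L2) ν') (mem_Ici.2 hν))
        (Module.End.mem_eigenspace_iff.2 hx)
    have hli : LinearIndependent ℝ
        ![(⟨ψ, hmem μ ψ hlt.le hψ⟩ : U), ⟨χ, hmem l χ le_rfl hχ⟩] := by
      rw [LinearIndependent.pair_iff]
      intro s t hst
      have hst' : s • ψ + t • χ = 0 := congrArg Subtype.val hst
      have h1 : ⟪ψ, s • ψ + t • χ⟫_ℝ = 0 := by rw [hst', inner_zero_right]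
      have h2 : ⟪χ, s • ψ + t • χ⟫_ℝ = 0 := by rw [hst', inner_zero_right]
      rw [inner_add_right, real_inner_smul_right, real_inner_smul_right, hort, mul_zero, add_zero]
        at h1
      rw [inner_add_right, real_inner_smul_right, real_inner_smul_right, real_inner_comm, hort,
        mul_zero, zero_add] at h2
      exact ⟨(mul_eq_zero.1 h1).resolve_right (inner_self_ne_zero.2 hψ0),
        (mul_eq_zero.1 h2).resolve_right (inner_self_ne_zero.2 hχ0)⟩
    simpa using hli.cardinal_le_rank
  · by_contra hlν
    rw [not_le] at hlν
    have hle : (⨆ ν' ∈ Ici ν, Module.End.eigenspace (T : Module.End ℝ L2) ν' : Submodule ℝ L2) ≤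
        ℝ ∙ ψ := by
      refine iSup₂_le fun ν' hν' x hx => ?_
      obtain ⟨a, rfl⟩ := exists_eq_smul_of_lt hψ hψ0 hl (hlν.trans_le hν')
        (Module.End.mem_eigenspace_iff.1 hx)
      exact Submodule.mem_span_singleton.2 ⟨a, rfl⟩
    have h1 := (hν.2.trans (Submodule.rank_mono hle)).trans (rank_span_le (R := ℝ) {ψ})
    rw [Cardinal.mk_singleton] at h1
    norm_num at h1

/-- The spectral picture of `weightedOp p` at the top of its spectrum. The gap bound depends on
the bounds `m` and `M` of the weight only. -/
theorem exists_ground_state {p : C(I, ℝ)} {m M : ℝ} (hm : 0 < m) (hmp : ∀ z, m ≤ p z)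
    (hpM : ∀ z, p z ≤ M) :
    ∃ (ψ : L2) (l : ℝ), weightedOp p ψ = ‖weightedOp p‖ • ψ ∧ 0 ≤ ψ ∧ ⟪toL2 p, ψ⟫_ℝ = 1 ∧
      (∀ x, ⟪ψ, x⟫_ℝ = 0 → ⟪x, weightedOp p x⟫_ℝ ≤ l * ‖x‖ ^ 2) ∧
      (m ^ 2 / 11) ^ 2 / (Real.sinh 1 * M ^ 2) ≤ ‖weightedOp p‖ - l ∧
      IsGreatest {ν | Module.End.HasEigenvalue (weightedOp p : Module.End ℝ L2) ν}
        ‖weightedOp p‖ ∧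
      Module.End.HasEigenvalue (weightedOp p : Module.End ℝ L2) l ∧
      nthEigenvalue (weightedOp p) 1 = ‖weightedOp p‖ ∧ nthEigenvalue (weightedOp p) 2 = l := by
  have hp : ∀ z, 0 < p z := fun z => hm.trans_le (hmp z)
  have hM : 0 < M := (hp 0).trans_le (hpM 0)
  obtain ⟨ψ, hψ, hψnn, hψ1⟩ := exists_nonneg_eigenvector hp
  have hψ0 : ψ ≠ 0 := fun h => by simp [h] at hψ1
  obtain ⟨l, χ, hχ0, hort, hχ, hl⟩ := exists_eigenvector_orthogonal
    (isCompactOperator_weightedOp p) (weightedOp_isSymmetric p) (inner_weightedOp_nonneg p) hψ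
    (exists_orthogonal_ne_zero ψ)
  have hgap := eigenvalue_le_of_orthogonal hp hψ hψnn hψ1 hχ hχ0 hort
  have hs := sinh_one_pos
  have hpn : ‖toL2 p‖ ≤ M := (norm_toL2_le p).trans ((ContinuousMap.norm_le _ hM.le).2 fun z => by
    rw [Real.norm_of_nonneg (hp z).le]; exact hpM z)
  have h1 : 1 ≤ M * ‖ψ‖ := by
    have h := real_inner_le_norm (toL2 p) ψ
    rw [hψ1] at h
    exact h.trans (by gcongr)
  have h2 : 1 ≤ M ^ 2 * ‖ψ‖ ^ 2 := by
    rw [← mul_pow]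
    exact one_le_pow₀ h1
  have hgap' : (m ^ 2 / 11) ^ 2 / (Real.sinh 1 * M ^ 2) ≤ ‖weightedOp p‖ - l := by
    have h3 : (m ^ 2 / 11) ^ 2 / (Real.sinh 1 * M ^ 2)
        ≤ ‖weightedOp p‖ ^ 2 / Real.sinh 1 * ‖ψ‖ ^ 2 := by
      calc (m ^ 2 / 11) ^ 2 / (Real.sinh 1 * M ^ 2)
          ≤ ‖weightedOp p‖ ^ 2 / (Real.sinh 1 * M ^ 2) * (M ^ 2 * ‖ψ‖ ^ 2) := by
            refine le_trans ?_ (le_mul_of_one_le_right (by positivity) h2)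
            gcongr
            exact norm_weightedOp_ge hm hmp
        _ = ‖weightedOp p‖ ^ 2 / Real.sinh 1 * ‖ψ‖ ^ 2 := by field_simp
    linarith
  have hpos : 0 < (m ^ 2 / 11) ^ 2 / (Real.sinh 1 * M ^ 2) := by positivity
  have hgr := isGreatest_eigenvalue hψ hψ0 (inner_weightedOp_le p)
  exact ⟨ψ, l, hψ, hψnn, hψ1, hl, hgap', hgr, hasEigenvalue_of_apply_eq hχ hχ0,
    nthEigenvalue_one hgr, nthEigenvalue_two hψ hψ0 hχ hχ0 hort hl (by linarith)⟩

/-! ### Perturbation of the weight -/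

theorem norm_weightedOp_sub_le {p q : C(I, ℝ)} {M τ : ℝ} (hp : ∀ z, |p z| ≤ M)
    (hq : ∀ z, |q z| ≤ M) (hpq : ∀ z, |q z - p z| ≤ τ) :
    ‖weightedOp q - weightedOp p‖ ≤ 2 * M * ‖P0inv‖ * τ := by
  have h : weightedOp q - weightedOp p =
      mulOp (q - p) ∘L P0inv ∘L mulOp q + mulOp p ∘L P0inv ∘L mulOp (q - p) := by
    rw [mulOp_sub]
    ext1 f
    simp [weightedOp]
  have hd : ‖mulOp (q - p)‖ ≤ τ := norm_mulOp_le hpq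
  have hp' := norm_mulOp_le hp
  have hq' := norm_mulOp_le hq
  have hτ : 0 ≤ τ := (abs_nonneg _).trans (hpq 0)
  have hM : 0 ≤ M := (abs_nonneg _).trans (hp 0)
  have hc : ∀ A B : L2 →L[ℝ] L2, ∀ a b : ℝ, 0 ≤ a → ‖A‖ ≤ a → ‖B‖ ≤ b →
      ‖A ∘L P0inv ∘L B‖ ≤ a * (‖P0inv‖ * b) := by
    intro A B a b ha hA hB
    refine (A.opNorm_comp_le _).trans ?_
    refine mul_le_mul hA ((P0inv.opNorm_comp_le B).trans ?_) (norm_nonneg _) ha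
    gcongr
  rw [h]
  refine (norm_add_le _ _).trans ?_
  have h1 := hc _ _ _ _ hτ hd hq'
  have h2 := hc _ _ _ _ hM hp' hd
  linarith

/-- Conjugation by the ratio of the weights. If `φ` is a nonnegative eigenvector for the weight `q`,
then `χ = q φ / p` has the same normalization with respect to `p` and is an approximate eigenvector
for the weight `p`, with defect `(q² - p²) P0inv (q φ) / p`. -/
theorem exists_approx_eigenvector {p q : C(I, ℝ)} {m τ ν : ℝ} (hm : 0 < m)
    (hmp : ∀ z, m ≤ p z) (hmq : ∀ z, m ≤ q z) (hpq : ∀ z, |q z - p z| ≤ τ) {φ : L2}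
    (hφ : weightedOp q φ = ν • φ) (hφ0 : 0 ≤ φ) (hφ1 : ⟪toL2 q, φ⟫_ℝ = 1) :
    ∃ χ : L2, ⟪toL2 p, χ⟫_ℝ = 1 ∧ ‖ν • χ - weightedOp p χ‖ ≤ τ * (2 + τ / m) / 4 ∧
      ‖φ - χ‖ ≤ τ / m * ‖χ‖ := by
  have hp : ∀ z, 0 < p z := fun z => hm.trans_le (hmp z)
  have hq : ∀ z, 0 < q z := fun z => hm.trans_le (hmq z)
  have hτ : 0 ≤ τ := (abs_nonneg _).trans (hpq 0)
  let r : C(I, ℝ) := ⟨fun z => q z / p z, q.continuous.div p.continuous fun z => (hp z).ne'⟩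
  have hr : ∀ z, r z = q z / p z := fun _ => rfl
  have hpr : p * r = q := by
    ext z
    rw [ContinuousMap.mul_apply, hr, mul_div_cancel₀ _ (hp z).ne']
  set χ := mulOp r φ with hχ
  have hpχ : mulOp p χ = mulOp q φ := by rw [hχ, mulOp_mulOp, hpr]
  refine ⟨χ, ?_, ?_, ?_⟩
  · rw [← integral_mulOp, hpχ, integral_mulOp, hφ1]
  · refine norm_L2_le_of_ae_bound (by positivity) ?_
    have hsrc := (Lp.coeFn_nonneg _).2 (mulOp_nonneg (fun z => (hq z).le) hφ0)
    have hνχ : ν • χ = mulOp r (weightedOp q φ) := by rw [hφ, map_smul]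
    filter_upwards [Lp.coeFn_sub (ν • χ) (weightedOp p χ), mulOp_coe r (weightedOp q φ),
      mulOp_coe q (P0inv (mulOp q φ)), mulOp_coe p (P0inv (mulOp q φ)),
      P0inv_coe (mulOp q φ)] with z h1 h2 h3 h4 h5
    have hF0 : 0 ≤ P0inv (mulOp q φ) z := by
      rw [h5]; exact integral_green_nonneg hsrc z
    have hF1 : P0inv (mulOp q φ) z ≤ 1 / 4 := by
      rw [h5]
      refine (integral_green_le hsrc z).trans ?_
      rw [integral_mulOp, hφ1, mul_one]
      exact green_diag_le z
    have h6 : (weightedOp p χ : I → ℝ) z = p z * P0inv (mulOp q φ) z := by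
      rw [weightedOp_apply, hpχ, h4]
    rw [h1, Pi.sub_apply, hνχ, h2, weightedOp_apply, h3, h6, hr]
    set F := P0inv (mulOp q φ) z
    have h7 : q z / p z * (q z * F) - p z * F
        = (q z - p z) * (2 + (q z - p z) / p z) * F := by
      have := (hp z).ne'
      field_simp
      ring
    have h8 : |(q z - p z) / p z| ≤ τ / m := by
      rw [abs_div, abs_of_pos (hp z)]
      exact div_le_div₀ hτ (hpq z) hm (hmp z)
    have h9 : |2 + (q z - p z) / p z| ≤ 2 + τ / m :=
      (abs_add_le _ _).trans (by rw [abs_two]; linarith)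
    rw [h7, abs_mul, abs_mul, abs_of_nonneg hF0]
    calc |q z - p z| * |2 + (q z - p z) / p z| * F ≤ τ * (2 + τ / m) * (1 / 4) := by
          gcongr
          exact hpq z
      _ = τ * (2 + τ / m) / 4 := by ring
  · refine Lp.norm_le_mul_norm_of_ae_le_mul ?_
    filter_upwards [Lp.coeFn_sub φ χ, mulOp_coe r φ] with z h1 h2
    rw [h1, Pi.sub_apply, hχ, h2, hr]
    have h3 : φ z - q z / p z * φ z = -((q z - p z) / q z) * (q z / p z * φ z) := by
      have := (hp z).ne'
      have := (hq z).ne'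
      field_simp
      ring
    rw [h3, norm_mul]
    refine mul_le_mul_of_nonneg_right ?_ (norm_nonneg _)
    rw [norm_neg, norm_div, Real.norm_of_nonneg (hq z).le, Real.norm_eq_abs]
    exact div_le_div₀ hτ (hpq z) hm (hmq z)

/-- The arithmetic of the eigenvector bound: `N ≥ 1/11` makes `16 N` larger than the constant
`1.05 · 1.025 / 0.9` produced by a perturbation that is small relative to `m` and to the gap. -/
theorem eigenvector_bound_arith {m M N τ g g' a r n : ℝ} (hm : 0 < m) (hM : 0 < M)
    (hN : 1 / 11 ≤ N) (hτ : 0 ≤ τ) (hτm : τ / m ≤ 1 / 20) (hg : 0 < g) (hg' : 9 / 10 * g ≤ g')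
    (hn : 0 ≤ n) (ha : a ≤ τ / m * (n + r))
    (hr : r ≤ 2 * M * (τ * (2 + τ / m) / 4 / g') * n) :
    a + r ≤ 2 * (τ / m + 8 * M * N * τ / g) * n := by
  have hg'0 : 0 < g' := lt_of_lt_of_le (by positivity) hg'
  set s := τ / m with hs
  have hs0 : 0 ≤ s := by positivity
  set x := M * τ / g * n with hx
  have hx0 : 0 ≤ x := by positivity
  have h1 : r ≤ 41 / 36 * x := by
    calc r ≤ 2 * M * (τ * (2 + s) / 4 / g') * n := hr
      _ ≤ 2 * M * (τ * (2 + 1 / 20) / 4 / (9 / 10 * g)) * n := by gcongr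
      _ = 41 / 36 * x := by rw [hx]; field_simp; ring
  have h2 : s * r ≤ 1 / 20 * (41 / 36 * x) :=
    (mul_le_mul_of_nonneg_left h1 hs0).trans (mul_le_mul_of_nonneg_right hτm (by positivity))
  have h3 : 2 * (s + 8 * M * N * τ / g) * n = 2 * s * n + 16 * N * x := by
    rw [hx]; field_simp; ring
  have h4 : 16 / 11 * x ≤ 16 * N * x := mul_le_mul_of_nonneg_right (by linarith) hx0
  have h5 : 0 ≤ s * n := by positivity
  rw [h3]
  nlinarith

theorem normalized_iff (Sig : C(ℝ, ℝ)) (h : C(I, ℝ)) (ψ : L2) :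
    IsNormalizedEigenvector Sig h ψ ↔ weightedOp (sqrtSigma Sig h) ψ = mu Sig h • ψ ∧
      ⟪toL2 (sqrtSigma Sig h), ψ⟫_ℝ = 1 := by
  rw [inner_toL2_left]
  rfl

/-- The second-order expansion of the top eigenvalue under a change of weight. -/
theorem abs_norm_weightedOp_sub_le {p q : C(I, ℝ)} {M τ l : ℝ} (hp : ∀ z, |p z| ≤ M)
    (hq : ∀ z, |q z| ≤ M) (hpq : ∀ z, |q z - p z| ≤ τ) {ψ φ : L2}
    (hψ : weightedOp p ψ = ‖weightedOp p‖ • ψ) (hψ0 : ψ ≠ 0)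
    (hφ : weightedOp q φ = ‖weightedOp q‖ • φ) (hφ0 : φ ≠ 0)
    (hl : ∀ x, ⟪ψ, x⟫_ℝ = 0 → ⟪x, weightedOp p x⟫_ℝ ≤ l * ‖x‖ ^ 2) (hlt : l < ‖weightedOp p‖) :
    |‖weightedOp q‖ - ‖weightedOp p‖ - ⟪ψ, (weightedOp q - weightedOp p) ψ⟫_ℝ / ‖ψ‖ ^ 2|
      ≤ 8 * M ^ 2 * ‖P0inv‖ ^ 2 * τ ^ 2 / (‖weightedOp p‖ - l) := by
  refine (abs_eigenvalue_sub_le (weightedOp_isSymmetric p) (weightedOp_isSymmetric q) hψ hψ0 hφ hφ0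
    (inner_weightedOp_le q) hl hlt (norm_weightedOp_sub_le hp hq hpq)).trans ?_
  refine div_le_div_of_nonneg_right ?_ (sub_pos.2 hlt).le
  linarith [sq_nonneg (2 * M * ‖P0inv‖ * τ)]

theorem abs_inner_weightedOp_sub_le {p q : C(I, ℝ)} {M τ : ℝ} (hp : ∀ z, |p z| ≤ M)
    (hq : ∀ z, |q z| ≤ M) (hpq : ∀ z, |q z - p z| ≤ τ) {ψ : L2} (hψ0 : ψ ≠ 0) :
    |⟪ψ, (weightedOp q - weightedOp p) ψ⟫_ℝ / ‖ψ‖ ^ 2| ≤ 2 * M * ‖P0inv‖ * τ := by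
  have hn : 0 < ‖ψ‖ := norm_pos_iff.2 hψ0
  rw [abs_div, abs_of_pos (by positivity : 0 < ‖ψ‖ ^ 2), div_le_iff₀ (by positivity)]
  refine (abs_real_inner_le_norm _ _).trans ?_
  have h := ContinuousLinearMap.le_of_opNorm_le _ (norm_weightedOp_sub_le hp hq hpq) ψ
  have h' := mul_le_mul_of_nonneg_left h hn.le
  linarith

/-- The Lipschitz bound for the normalized ground states under a change of weight that is small
relative to the lower bound `m` and to the spectral gap. -/
theorem norm_groundState_sub_le {p q : C(I, ℝ)} {m M τ l : ℝ} (hm : 0 < m)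
    (hmp : ∀ z, m ≤ p z) (hmq : ∀ z, m ≤ q z) (hp : ∀ z, |p z| ≤ M) (hq : ∀ z, |q z| ≤ M)
    (hpq : ∀ z, |q z - p z| ≤ τ) {ψ φ : L2} (hψ : weightedOp p ψ = ‖weightedOp p‖ • ψ)
    (hψ1 : ⟪toL2 p, ψ⟫_ℝ = 1) (hφ : weightedOp q φ = ‖weightedOp q‖ • φ) (hφ0 : 0 ≤ φ)
    (hφ1 : ⟪toL2 q, φ⟫_ℝ = 1)
    (hl : ∀ x, ⟪ψ, x⟫_ℝ = 0 → ⟪x, weightedOp p x⟫_ℝ ≤ l * ‖x‖ ^ 2) (hlt : l < ‖weightedOp p‖)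
    (hτm : τ / m ≤ 1 / 20) (hτg : 2 * M * ‖P0inv‖ * τ ≤ (‖weightedOp p‖ - l) / 10) :
    ‖φ - ψ‖ ≤ 2 * (τ / m + 8 * M * ‖P0inv‖ * τ / (‖weightedOp p‖ - l)) * ‖ψ‖ := by
  have hτ : 0 ≤ τ := (abs_nonneg _).trans (hpq 0)
  have hM : 0 < M := hm.trans_le ((hmp 0).trans ((le_abs_self _).trans (hp 0)))
  obtain ⟨χ, c1, c2, c3⟩ := exists_approx_eigenvector hm hmp hmq hpq hφ hφ0 hφ1
  have hμ : ‖weightedOp p‖ - ‖weightedOp q‖ ≤ 2 * M * ‖P0inv‖ * τ := by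
    have h := norm_weightedOp_sub_le hp hq hpq
    rw [norm_sub_rev] at h
    exact (norm_sub_norm_le _ _).trans h
  have hg : 0 < ‖weightedOp p‖ - l := sub_pos.2 hlt
  have hg' : 9 / 10 * (‖weightedOp p‖ - l) ≤ ‖weightedOp q‖ - l := by linarith
  have hlq : 0 < ‖weightedOp q‖ - l := by linarith
  have hd : ‖χ - ψ‖ ≤ 2 * M * (τ * (2 + τ / m) / 4 / (‖weightedOp q‖ - l)) * ‖ψ‖ := by
    refine (norm_sub_eigenvector_le hψ hl (sub_pos.1 hlq) hψ1 c1).trans ?_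
    have hpM : ‖toL2 p‖ ≤ M := (norm_toL2_le p).trans ((ContinuousMap.norm_le _ hM.le).2 hp)
    have hdiv := div_le_div_of_nonneg_right c2 hlq.le
    have h0 : 0 ≤ ‖‖weightedOp q‖ • χ - weightedOp p χ‖ / (‖weightedOp q‖ - l) := by positivity
    refine mul_le_mul_of_nonneg_right ?_ (norm_nonneg ψ)
    exact mul_le_mul (by linarith) hdiv h0 (by linarith)
  have hsplit : ‖φ - χ‖ ≤ τ / m * (‖ψ‖ + ‖χ - ψ‖) := by
    refine c3.trans (mul_le_mul_of_nonneg_left ?_ (by positivity))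
    have h := norm_add_le ψ (χ - ψ)
    rwa [add_sub_cancel] at h
  exact (norm_sub_le_norm_sub_add_norm_sub φ χ ψ).trans
    (eigenvector_bound_arith hm hM norm_P0inv_ge hτ hτm hg hg' (norm_nonneg ψ) hsplit hd)

/-! ### The operators `L_h` -/

theorem eq_of_isNormalizedEigenvector {Sig : C(ℝ, ℝ)} {h : C(I, ℝ)} {ψ : L2} {l : ℝ}
    (hψ : IsNormalizedEigenvector Sig h ψ)
    (hl : ∀ x, ⟪ψ, x⟫_ℝ = 0 → ⟪x, weightedOp (sqrtSigma Sig h) x⟫_ℝ ≤ l * ‖x‖ ^ 2)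
    (hlt : l < mu Sig h) {φ : L2} (hφ : IsNormalizedEigenvector Sig h φ) : φ = ψ := by
  rw [normalized_iff] at hψ hφ
  have hψ0 : ψ ≠ 0 := fun h0 => by simp [h0] at hψ
  obtain ⟨a, rfl⟩ := exists_eq_smul_of_lt hψ.1 hψ0 hl hlt hφ.1
  have h1 := hφ.2
  rw [real_inner_smul_right, hψ.2, mul_one] at h1
  rw [h1, one_smul]

end Neutronics

end

open Neutronics in
theorem mainTheorem12 (Sig : C(ℝ, ℝ)) (M₀ Sig₀ C₀ : ℝ) (B : Set C(unitInterval, ℝ))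
    (hM₀ : 0 < M₀) (hSig₀ : 0 < Sig₀) (hSig : ∀ s ∈ Set.Icc (-M₀) M₀, Sig₀ ≤ Sig s)
    (hB : ∀ h ∈ B, ‖h‖ ≤ M₀)
    (hC₀ : ∀ h ∈ B, ∀ k ∈ B, ∀ z : unitInterval, |√(Sig (h z)) - √(Sig (k z))| ≤ C₀ * ‖h - k‖) :
    (∀ h ∈ B,
      IsCompactOperator (Neutronics.opL Sig h) ∧
      IsSelfAdjoint (Neutronics.opL Sig h) ∧
      IsGreatest {ν | Module.End.HasEigenvalue (Neutronics.opL Sig h : Module.End ℝ Neutronics.L2) ν}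
        (Neutronics.mu Sig h) ∧
      Module.End.HasEigenvalue (Neutronics.opL Sig h : Module.End ℝ Neutronics.L2)
        (Neutronics.mu2 Sig h) ∧
      Neutronics.mu2 Sig h < Neutronics.mu Sig h ∧
      ∃! ψ, Neutronics.IsNormalizedEigenvector Sig h ψ) ∧
    ∃ ε₀ > 0, ∀ h ∈ B, ∀ k ∈ B, ‖h - k‖ ≤ ε₀ →
      ∀ ψ φ : Neutronics.L2, Neutronics.IsNormalizedEigenvector Sig h ψ →
        Neutronics.IsNormalizedEigenvector Sig k φ →
        |Neutronics.mu Sig k - Neutronics.mu Sig h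
            - inner ℝ ψ ((Neutronics.opL Sig k - Neutronics.opL Sig h) ψ) / ‖ψ‖ ^ 2|
          ≤ 8 * Neutronics.supSigma Sig M₀ * (‖Neutronics.P0inv‖ * C₀) ^ 2 * ‖h - k‖ ^ 2
              / (Neutronics.mu Sig h - Neutronics.mu2 Sig h) ∧
        |inner ℝ ψ ((Neutronics.opL Sig k - Neutronics.opL Sig h) ψ) / ‖ψ‖ ^ 2|
          ≤ 2 * √(Neutronics.supSigma Sig M₀) * ‖Neutronics.P0inv‖ * C₀ * ‖h - k‖ ∧
        |Neutronics.mu Sig k - Neutronics.mu Sig h|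
          ≤ 2 * √(Neutronics.supSigma Sig M₀) * ‖Neutronics.P0inv‖ * C₀ * ‖h - k‖
            + 8 * Neutronics.supSigma Sig M₀ * (‖Neutronics.P0inv‖ * C₀) ^ 2 * ‖h - k‖ ^ 2
              / (Neutronics.mu Sig h - Neutronics.mu2 Sig h) ∧
        ‖φ - ψ‖
          ≤ 2 * (C₀ / √Sig₀ + 8 * √(Neutronics.supSigma Sig M₀) * ‖Neutronics.P0inv‖ * C₀
                / (Neutronics.mu Sig h - Neutronics.mu2 Sig h)) * ‖h - k‖ * ‖ψ‖ := by
  set m := √Sig₀ with hm_def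
  set M := √(supSigma Sig M₀) with hM_def
  set N := ‖P0inv‖ with hN_def
  have hm : 0 < m := Real.sqrt_pos.2 hSig₀
  have hN : 1 / 11 ≤ N := norm_P0inv_ge
  have hrange : ∀ h ∈ B, ∀ z : unitInterval, h z ∈ Set.Icc (-M₀) M₀ := fun h hh z =>
    abs_le.1 ((h.norm_coe_le_norm z).trans (hB h hh))
  have hpm : ∀ h ∈ B, ∀ z, m ≤ sqrtSigma Sig h z := fun h hh z =>
    Real.sqrt_le_sqrt (hSig _ (hrange h hh z))
  have hpM : ∀ h ∈ B, ∀ z, sqrtSigma Sig h z ≤ M := fun h hh z =>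
    Real.sqrt_le_sqrt ((le_abs_self _).trans
      ((Sig.restrict (Set.Icc (-M₀) M₀)).norm_coe_le_norm ⟨h z, hrange h hh z⟩))
  have hM2 : M ^ 2 = supSigma Sig M₀ := Real.sq_sqrt (norm_nonneg _)
  have hM : 0 < M := hm.trans_le (Real.sqrt_le_sqrt ((hSig 0 ⟨by linarith, hM₀.le⟩).trans
    ((le_abs_self _).trans
      ((Sig.restrict (Set.Icc (-M₀) M₀)).norm_coe_le_norm ⟨0, by linarith, hM₀.le⟩))))
  -- a lower bound for all the gaps, uniform in `B`
  set g₀ := (m ^ 2 / 11) ^ 2 / (Real.sinh 1 * M ^ 2) with hg₀_def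
  have hg₀ : 0 < g₀ := by
    have := sinh_one_pos
    positivity
  have spec : ∀ h ∈ B, ∃ ψ : L2, IsNormalizedEigenvector Sig h ψ ∧ 0 ≤ ψ ∧
      (∀ x, inner ℝ ψ x = 0 →
        inner ℝ x (weightedOp (sqrtSigma Sig h) x) ≤ mu2 Sig h * ‖x‖ ^ 2) ∧
      g₀ ≤ mu Sig h - mu2 Sig h ∧
      IsGreatest {ν | Module.End.HasEigenvalue (opL Sig h : Module.End ℝ L2) ν} (mu Sig h) ∧
      Module.End.HasEigenvalue (opL Sig h : Module.End ℝ L2) (mu2 Sig h) ∧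
      mu Sig h = ‖weightedOp (sqrtSigma Sig h)‖ := by
    intro h hh
    obtain ⟨ψ, l, h1, h2, h3, h4, h5, h6, h7, h8, h9⟩ :=
      exists_ground_state hm (hpm h hh) (hpM h hh)
    have e1 : mu Sig h = ‖weightedOp (sqrtSigma Sig h)‖ := h8
    have e2 : mu2 Sig h = l := h9
    rw [e1, e2]
    exact ⟨ψ, (normalized_iff Sig h ψ).2 ⟨e1 ▸ h1, h3⟩, h2, h4, h5, h6, h7, rfl⟩
  refine ⟨fun h hh => ?_, ?_⟩
  · obtain ⟨ψ, h1, -, h3, h4, h5, h6, -⟩ := spec h hh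
    exact ⟨isCompactOperator_weightedOp _, (weightedOp_isSymmetric _).isSelfAdjoint, h5, h6,
      by linarith, ψ, h1, fun φ hφ => eq_of_isNormalizedEigenvector h1 h3 (by linarith) hφ⟩
  -- this keeps `C₀ ‖h - k‖` below `m / 20` and the change of `μ` below a tenth of every gap
  refine ⟨min (m / 20) (g₀ / (20 * (M * N))) / (|C₀| + 1), by positivity, ?_⟩
  intro h hh k hk hε ψ φ hψ hφ
  obtain ⟨ψ', h1, -, h3, h4, -, -, h7⟩ := spec h hh
  obtain ⟨φ', k1, k2, k3, k4, -, -, k7⟩ := spec k hk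
  obtain rfl := eq_of_isNormalizedEigenvector h1 h3 (by linarith) hψ
  obtain rfl := eq_of_isNormalizedEigenvector k1 k3 (by linarith) hφ
  rw [normalized_iff] at h1 k1
  set p := sqrtSigma Sig h with hp_def
  set q := sqrtSigma Sig k with hq_def
  set g := mu Sig h - mu2 Sig h with hg_def
  have hg : 0 < g := by linarith
  set τ := C₀ * ‖h - k‖ with hτ_def
  have hpq : ∀ z, |q z - p z| ≤ τ := fun z => by rw [abs_sub_comm]; exact hC₀ h hh k hk z
  -- holds for negative `C₀` too, since the hypothesis then forces `h = k`
  have hτ : 0 ≤ τ := (abs_nonneg _).trans (hpq 0)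
  have hτ_le : τ ≤ min (m / 20) (g₀ / (20 * (M * N))) := by
    rw [le_div_iff₀ (by positivity)] at hε
    refine le_trans ?_ hε
    rw [hτ_def, mul_comm]
    exact mul_le_mul_of_nonneg_left ((le_abs_self C₀).trans (by linarith)) (norm_nonneg _)
  have hτ1 : τ ≤ m / 20 := hτ_le.trans (min_le_left _ _)
  have hτ2 : 20 * (M * N) * τ ≤ g₀ := by
    have := hτ_le.trans (min_le_right _ _)
    rw [le_div_iff₀ (by positivity)] at this
    linarith
  have habs : ∀ h ∈ B, ∀ z, |sqrtSigma Sig h z| ≤ M := fun h hh z => by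
    rw [abs_of_nonneg (hm.le.trans (hpm h hh z))]
    exact hpM h hh z
  have hψ0 : ψ ≠ 0 := fun h0 => by simp [h0] at h1
  have hφ0 : φ ≠ 0 := fun h0 => by simp [h0] at k1
  have hopL : opL Sig k - opL Sig h = weightedOp q - weightedOp p := rfl
  have h1' := h7 ▸ h1.1
  have k1' := k7 ▸ k1.1
  have hlt : mu2 Sig h < ‖weightedOp p‖ := by linarith
  have b1 : |mu Sig k - mu Sig h - inner ℝ ψ ((weightedOp q - weightedOp p) ψ) / ‖ψ‖ ^ 2|
      ≤ 8 * supSigma Sig M₀ * (N * C₀) ^ 2 * ‖h - k‖ ^ 2 / g := by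
    have := abs_norm_weightedOp_sub_le (habs h hh) (habs k hk) hpq h1' hψ0 k1' hφ0 h3 hlt
    rw [← k7, ← h7, hM2] at this
    convert this using 2
    rw [hτ_def]
    ring
  have b2 : |inner ℝ ψ ((weightedOp q - weightedOp p) ψ) / ‖ψ‖ ^ 2|
      ≤ 2 * M * N * C₀ * ‖h - k‖ := by
    have := abs_inner_weightedOp_sub_le (habs h hh) (habs k hk) hpq hψ0
    rwa [hτ_def, ← mul_assoc] at this
  have b3 : ‖φ - ψ‖ ≤ 2 * (τ / m + 8 * M * N * τ / g) * ‖ψ‖ := by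
    rw [hg_def, h7]
    refine norm_groundState_sub_le hm (hpm h hh) (hpm k hk) (habs h hh) (habs k hk) hpq h1' h1.2
      k1' k2 k1.2 h3 hlt ?_ ?_
    · rw [div_le_iff₀ hm]; linarith
    · rw [← h7]; linarith
  rw [hopL]
  refine ⟨b1, b2, ?_, b3.trans_eq ?_⟩
  · have := abs_add_le (inner ℝ ψ ((weightedOp q - weightedOp p) ψ) / ‖ψ‖ ^ 2)
      (mu Sig k - mu Sig h - inner ℝ ψ ((weightedOp q - weightedOp p) ψ) / ‖ψ‖ ^ 2)
    rw [add_sub_cancel] at this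
    linarith
  · rw [hτ_def]; ring
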